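/- **Theorem (Variable selection consistency).** For each sample size $n$ consider the grouped linear model $\mathbf y=\sum_{g=1}^{G_n}\mathbf X_g\boldsymbol\beta_g+\boldsymbol\epsilon$, $\boldsymbol\epsilon\sim N(\mathbf 0,\sigma^2 I_n)$, with known fixed $\sigma^2>0$, $G_n\le n$ groups, and $n\times m_g$ blocks $\mathbf X_g$ of full column rank satisfying $\mathbf X_g^{\mathrm T}\mathbf X_h=\mathbf 0$ for $g\ne h$ (the design, the group sizes and the coefficients may change with $n$). Let $\boldsymbol\beta_g^0$ be the true coefficients, $\mathcal A_n=\{g:\boldsymbol\beta^0_g\ne\mathbf 0\}$ the set of active groups, $G_{\mathcal A_n}=|\mathcal A_n|$, $r_n=G_{\mathcal A_n}/G_n$ and $\mathbf Q_{n,g}=\mathbf X_g^{\mathrm T}\mathbf X_g/n$. Consider the Bayesian hierarchy, with a tuning parameter $\tau_n>0$: $\mathbf y\mid\boldsymbol\beta\sim N_n(\mathbf X\boldsymbol\beta,\sigma^2I_n)$; given $(\lambda_g^2)_g$, the $\boldsymbol\beta_g$ are independent with $\boldsymbol\beta_g\mid\lambda_g^2\sim N_{m_g}\big(\mathbf 0,\lambda_g^2\sigma^2\tau_n^2(\mathbf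 X_g^{\mathrm T}\mathbf X_g)^{-1}\big)$; and the $\lambda_g^2$ are independent with the (proper) density $\pi(t)\propto t^{-a-1}L(t)$ on $(0,\infty)$. Here $a\ge\frac12$, and $L:(0,\infty)\to(0,\infty)$ is measurable and slowly varying, that is, $L(\alpha x)/L(x)\to1$ as $x\to\infty$ for every $\alpha>0$, bounded above on $(0,\infty)$, and such that $L(t)\ge c_0$ for all $t\ge t_0$, for some $c_0,t_0>0$; $a$ and $L$ do not depend on $n$. Let $\kappa_g=1/(1+\lambda_g^2\tau_n^2)$, let $\mathcal D=\{\mathbf y\}$, and let $\widehat{\boldsymbol\beta}_g^{\mathrm{PM}}=E(\boldsymbol\beta_g\mid\tau_n,\sigma^2,\mathcal D)$ be the posterior mean. The half-thresholding rule declares group $g$ active if $E(1-\kappa_g\mid\tau_n,\sigma^2,\mathcal D)>\frac12$, and the half-thresholding estimator is $\widehat{\boldsymbol\beta}_g^{\mathrm{HT}}=\widehat{\boldsymbol\beta}_g^{\mathrm{PM}}\,I\{E(1-\kappa_g\mid\tau_n,\sigma^2,\mathcal D)>\frac12\}$. For nonnegative sequences write $u_n\lesssim v_n$ if $u_n\le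 Cv_n$ for some constant $C$ and all large $n$. Assume: * (A1) there is a constant $C_1>0$ such that, for all $n$ and all $g\in\mathcal A_n$, the smallest eigenvalue of $\mathbf Q_{n,g}$ exceeds $C_1$; * (A2) there are constants $c>0$ and $0\le b<\frac12$ such that $\min_j|\beta^0_{gj}|>c\,n^{-b}$ for all $n$ and all $g\in\mathcal A_n$; * (A3) the group sizes $m_g$ are bounded uniformly in $g$ and $n$; * (B1) $G_n^{\epsilon_1}\lesssim G_{\mathcal A_n}\lesssim G_n^{\epsilon_2}$ for some $0\le\epsilon_1<\epsilon_2<1$; * (B2) $\tau_n\to0$ and $r_n^{(1+\delta_2)/(1-\epsilon_2)}\lesssim\tau_n\lesssim r_n^{(1+\delta_1)/(1-\epsilon_1)}$ for some $\delta_2>\delta_1>\frac{\epsilon_2-\epsilon_1}{1-\epsilon_2}$, with the same $\epsilon_1,\epsilon_2$. Then, with $P$ the probability under the true coefficients $\boldsymbol\beta^0$, the half-thresholding rule is selection consistent, both for the set of groups declared active and for the set of groups with nonzero half-thresholding estimate: $$\lim_{n\to\infty}P\Big(\big\{g:E(1-\kappa_g\mid\tau_n,\sigma^2,\mathcal D)>\tfrac12\big\}=\mathcal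 A_n\Big)=1\quad\text{and}\quad \lim_{n\to\infty}P\Big(\big\{g:\widehat{\boldsymbol\beta}_g^{\mathrm{HT}}\ne\mathbf 0\big\}=\mathcal A_n\Big)=1.$$ -/

import Mathlib

open MeasureTheory ProbabilityTheory Filter Topology Asymptotics
open scoped Matrix

noncomputable section

namespace GroupHT

/-! ### The local prior -/

/-- Slow variation in Karamata's sense. -/
def IsSlowlyVarying (L : ℝ → ℝ) : Prop :=
  ∀ α : ℝ, 0 < α → Tendsto (fun x => L (α * x) / L x) atTop (𝓝 1)

/-- `L : (0,∞) → (0,∞)` is a measurable slowly varying function for which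
`t ↦ t ^ (-a-1) * L t` can be normalised to a probability density on `(0,∞)`.
Only the values of `L` on `(0,∞)` are ever used. -/
structure IsPriorFunction (a : ℝ) (L : ℝ → ℝ) : Prop where
  measurable : Measurable L
  pos : ∀ t, 0 < t → 0 < L t
  slowlyVarying : IsSlowlyVarying L
  integrable : IntegrableOn (fun t : ℝ => t ^ (-a - 1) * L t) (Set.Ioi 0)

/-- `L` is bounded away from zero near infinity and bounded above on `(0,∞)`. -/
def IsTailBounded (L : ℝ → ℝ) : Prop :=
  (∃ c₀ > 0, ∃ t₀ > 0, ∀ t, t₀ ≤ t → c₀ ≤ L t) ∧ ∃ M : ℝ, ∀ t, 0 < t → L t ≤ M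

/-- The prior law of `λ²`: density proportional to `t ^ (-a-1) * L t` on `(0,∞)`. -/
def localPrior (a : ℝ) (L : ℝ → ℝ) : Measure ℝ :=
  (volume.restrict (Set.Ioi (0 : ℝ))).withDensity fun t =>
    ENNReal.ofReal ((∫ u in Set.Ioi (0 : ℝ), u ^ (-a - 1) * L u)⁻¹ * (t ^ (-a - 1) * L t))

/-! ### The grouped linear model -/

section Model

variable {n G : ℕ} {m : Fin G → ℕ}

/-- The mean vector `X β = ∑ g, X_g β_g`. -/
def linPred (X : ∀ g, Matrix (Fin n) (Fin (m g)) ℝ)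
    (β : ∀ g, EuclideanSpace ℝ (Fin (m g))) : EuclideanSpace ℝ (Fin n) :=
  ∑ g, WithLp.toLp 2 (X g *ᵥ (β g).ofLp)

/-- The law `N_n(X β, σ² I_n)` of the response vector. -/
def dataLaw (X : ∀ g, Matrix (Fin n) (Fin (m g)) ℝ) (σ : ℝ)
    (β : ∀ g, EuclideanSpace ℝ (Fin (m g))) : Measure (EuclideanSpace ℝ (Fin n)) :=
  multivariateGaussian (linPred X β) (σ ^ 2 • (1 : Matrix (Fin n) (Fin n) ℝ))

/-- The density at `y` of `N_n(X β, σ² I_n)`. -/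
def likelihood (X : ∀ g, Matrix (Fin n) (Fin (m g)) ℝ) (σ : ℝ)
    (y : EuclideanSpace ℝ (Fin n)) (β : ∀ g, EuclideanSpace ℝ (Fin (m g))) : ℝ :=
  (2 * Real.pi * σ ^ 2) ^ (-(n : ℝ) / 2) * Real.exp (-‖y - linPred X β‖ ^ 2 / (2 * σ ^ 2))

/-- The conditional prior of `β` given the squared local parameters `l g = λ_g²`: independent
`N(0, λ_g² σ² τ² (X_gᵀ X_g)⁻¹)`. -/
def coefPrior (X : ∀ g, Matrix (Fin n) (Fin (m g)) ℝ) (σ τ : ℝ) (l : Fin G → ℝ) :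
    Measure (∀ g, EuclideanSpace ℝ (Fin (m g))) :=
  Measure.pi fun g => multivariateGaussian 0 ((l g * σ ^ 2 * τ ^ 2) • ((X g)ᵀ * X g)⁻¹)

/-- The marginal density of the data at `y` in the Bayesian hierarchical model. -/
def evidence (a : ℝ) (L : ℝ → ℝ) (X : ∀ g, Matrix (Fin n) (Fin (m g)) ℝ) (σ τ : ℝ)
    (y : EuclideanSpace ℝ (Fin n)) : ℝ :=
  ∫ l, ∫ β, likelihood X σ y β ∂(coefPrior X σ τ l) ∂(Measure.pi fun _ : Fin G => localPrior a L)

/-- The posterior expectation `E(f(λ², β) | τ, σ², y)` by Bayes' formula. -/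
def posteriorExp {E : Type*} [NormedAddCommGroup E] [NormedSpace ℝ E]
    (a : ℝ) (L : ℝ → ℝ) (X : ∀ g, Matrix (Fin n) (Fin (m g)) ℝ) (σ τ : ℝ)
    (y : EuclideanSpace ℝ (Fin n))
    (f : (Fin G → ℝ) → (∀ g, EuclideanSpace ℝ (Fin (m g))) → E) : E :=
  (evidence a L X σ τ y)⁻¹ •
    ∫ l, ∫ β, likelihood X σ y β • f l β ∂(coefPrior X σ τ l)
      ∂(Measure.pi fun _ : Fin G => localPrior a L)

/-- The shrinkage coefficient `κ = 1 / (1 + λ² τ²)`, as a function of `l = λ²`. -/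
def kappa (τ l : ℝ) : ℝ := 1 / (1 + l * τ ^ 2)

/-- The posterior shrinkage factor `E(1 - κ_g | τ, σ², y)`. -/
def shrinkFactor (a : ℝ) (L : ℝ → ℝ) (X : ∀ g, Matrix (Fin n) (Fin (m g)) ℝ) (σ τ : ℝ)
    (y : EuclideanSpace ℝ (Fin n)) (g : Fin G) : ℝ :=
  posteriorExp a L X σ τ y fun l _ => 1 - kappa τ (l g)

/-- The posterior mean of `β_g`. -/
def postMean (a : ℝ) (L : ℝ → ℝ) (X : ∀ g, Matrix (Fin n) (Fin (m g)) ℝ) (σ τ : ℝ)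
    (y : EuclideanSpace ℝ (Fin n)) (g : Fin G) : EuclideanSpace ℝ (Fin (m g)) :=
  posteriorExp a L X σ τ y fun _ β => β g

open Classical in
/-- The half-thresholding estimator of `β_g`. -/
def htEstimator (a : ℝ) (L : ℝ → ℝ) (X : ∀ g, Matrix (Fin n) (Fin (m g)) ℝ) (σ τ : ℝ)
    (y : EuclideanSpace ℝ (Fin n)) (g : Fin G) : EuclideanSpace ℝ (Fin (m g)) :=
  if 1 / 2 < shrinkFactor a L X σ τ y g then postMean a L X σ τ y g else 0

/-- The groups declared active by the rule `E(1 - κ_g | τ, σ², y) > 1/2`. -/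
def declaredActive (a : ℝ) (L : ℝ → ℝ) (X : ∀ g, Matrix (Fin n) (Fin (m g)) ℝ) (σ τ : ℝ)
    (y : EuclideanSpace ℝ (Fin n)) : Set (Fin G) :=
  {g | 1 / 2 < shrinkFactor a L X σ τ y g}

/-- The groups with nonzero half-thresholding estimate. -/
def estimatedActive (a : ℝ) (L : ℝ → ℝ) (X : ∀ g, Matrix (Fin n) (Fin (m g)) ℝ) (σ τ : ℝ)
    (y : EuclideanSpace ℝ (Fin n)) : Set (Fin G) :=
  {g | htEstimator a L X σ τ y g ≠ 0}

/-- The truly active groups. -/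
def activeSet (β : ∀ g, EuclideanSpace ℝ (Fin (m g))) : Set (Fin G) := {g | β g ≠ 0}

/-- Distinct blocks of the design are orthogonal. -/
def IsBlockOrthogonal (X : ∀ g, Matrix (Fin n) (Fin (m g)) ℝ) : Prop :=
  ∀ g h, g ≠ h → (X g)ᵀ * X h = 0

/-- The scaled Gram matrix `Q_{n,g} = X_gᵀ X_g / n`. -/
def gram (X : ∀ g, Matrix (Fin n) (Fin (m g)) ℝ) (g : Fin G) :
    Matrix (Fin (m g)) (Fin (m g)) ℝ :=
  (n : ℝ)⁻¹ • ((X g)ᵀ * X g)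

end Model

/-- The smallest eigenvalue of a nonempty symmetric matrix. -/
def eMin {k : ℕ} (A : Matrix (Fin k) (Fin k) ℝ) : ℝ := sInf (spectrum ℝ A)

end GroupHT

end

/-! The blocks of the design are orthogonal, so the Gaussian likelihood is a product over the groups
and so is the posterior. In one block, integrating out `β_g` given `λ_g²` is a Gaussian integral with
an exponential-quadratic weight: it leaves the weight
`κ ^ (m_g / 2) * exp ((1 - κ) H_g)` (`blockWeight`), where `2 σ² H_g = hatQuad (X g) y` is the squared
norm of the projection of `y` to the column space of `X_g`. Hence the shrinkage factor
`E(1 - κ_g | y)` is a ratio of two integrals against the local prior (`shrinkFactor_eq`), and the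
posterior mean is this factor times the least squares estimator (`postMean_eq`). In particular, the
two selection rules agree as long as `H_g > 0` on the active groups.

The ratio is controlled from both sides by the size of `H_g`:

* it is at most `C τ ^ q exp H_g` for each `q < 1`, because `1 - κ ≤ (λ² τ²) ^ (q / 2)` and the local
  prior has moments of all orders below `1 / 2` (`exists_shrink_upper_bound`);
* it is at least `3 / 4 - C τ ^ (-2a) exp (-H_g / 8)`, because the values `κ > 1 / 4` have weight at
  most `exp (3 H_g / 4)`, while `λ² τ² ∈ [7, 14]` has prior mass of order at least `τ ^ (2a)`
  (`exists_shrink_lower_bound`).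

For an inactive group `2 H_g` is a chi-square variable with boundedly many degrees of freedom, and
the first bound exceeds `1 / 2` with probability `O(τ ^ (q²))` by Markov's inequality for
`exp (q H_g)`. The window for `τ` gives `τ = O(G ^ (-E))` with `E > 1`, so that the sum of these
probabilities over at most `G` groups vanishes if `q² > 1 / E`. For an active group the signal
contributes at least a multiple of `n ^ (1 - 2b)` to `H_g`, outside an event whose probability is
exponentially small in `n ^ (1 - 2b)`, and `τ ^ (-2a)` is at most polynomial in `n`, so the second
bound exceeds `1 / 2` for all active groups at once. -/

namespace GroupHT

/-! ### Exponential-quadratic tilts of the standard Gaussian law -/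

section Tilt

/-- Completing the square: tilting the standard normal density by `exp (p x - q x² / 2)` gives, up
to a constant, the density of `N(p / (1 + q), 1 / (1 + q))`. -/
lemma exp_tilt_mul_gaussianPDFReal {q : ℝ} (hq : 0 < 1 + q) (p x : ℝ) :
    gaussianPDFReal 0 1 x * Real.exp (p * x - q * x ^ 2 / 2) =
      ((√(1 + q))⁻¹ * Real.exp (p ^ 2 / (2 * (1 + q)))) *
        gaussianPDFReal (p / (1 + q)) (1 + q)⁻¹.toNNReal x := by
  have h1 : ((1 + q)⁻¹.toNNReal : ℝ) = (1 + q)⁻¹ := Real.coe_toNNReal _ (by positivity)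
  have hs : √(2 * Real.pi * (1 + q)⁻¹) = √(2 * Real.pi) * (√(1 + q))⁻¹ := by
    rw [Real.sqrt_mul (by positivity), Real.sqrt_inv]
  have hs0 : √(1 + q) ≠ 0 := by positivity
  have hpi : √(2 * Real.pi) ≠ 0 := by positivity
  simp only [gaussianPDFReal_def, h1, hs, NNReal.coe_one, mul_one, sub_zero]
  rw [mul_assoc, ← Real.exp_add]
  have : -x ^ 2 / 2 + (p * x - q * x ^ 2 / 2) =
      p ^ 2 / (2 * (1 + q)) + -(x - p / (1 + q)) ^ 2 / (2 * (1 + q)⁻¹) := by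
    field_simp
    ring
  rw [this, Real.exp_add]
  field_simp

lemma integral_exp_tilt_mul_gaussianReal {q : ℝ} (hq : 0 < 1 + q) (p : ℝ) (f : ℝ → ℝ) :
    ∫ x, Real.exp (p * x - q * x ^ 2 / 2) * f x ∂(gaussianReal 0 1) =
      ((√(1 + q))⁻¹ * Real.exp (p ^ 2 / (2 * (1 + q)))) *
        ∫ x, f x ∂(gaussianReal (p / (1 + q)) (1 + q)⁻¹.toNNReal) := by
  have hv : (1 + q)⁻¹.toNNReal ≠ 0 := by simpa using hq
  rw [integral_gaussianReal_eq_integral_smul one_ne_zero,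
    integral_gaussianReal_eq_integral_smul hv, ← integral_const_mul]
  congr with x
  simp only [smul_eq_mul]
  rw [← mul_assoc, exp_tilt_mul_gaussianPDFReal hq]
  ring

lemma integrable_exp_tilt_mul_gaussianReal {q : ℝ} (hq : 0 < 1 + q) (p : ℝ) (f : ℝ → ℝ)
    (hf : Integrable f (gaussianReal (p / (1 + q)) (1 + q)⁻¹.toNNReal)) :
    Integrable (fun x => Real.exp (p * x - q * x ^ 2 / 2) * f x) (gaussianReal 0 1) := by
  have hv : (1 + q)⁻¹.toNNReal ≠ 0 := by simpa using hq
  rw [gaussianReal_of_var_ne_zero _ hv, integrable_withDensity_iff_integrable_smul'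
    (measurable_gaussianPDF _ _) (by simp [gaussianPDF_lt_top])] at hf
  rw [gaussianReal_of_var_ne_zero _ one_ne_zero, integrable_withDensity_iff_integrable_smul'
    (measurable_gaussianPDF _ _) (by simp [gaussianPDF_lt_top])]
  convert hf.const_mul ((√(1 + q))⁻¹ * Real.exp (p ^ 2 / (2 * (1 + q)))) using 2 with x
  simp only [smul_eq_mul, toReal_gaussianPDF]
  rw [← mul_assoc, exp_tilt_mul_gaussianPDFReal hq]
  ring

variable {ι : Type*} [Fintype ι]

/-- The exponential-quadratic weight `z ↦ exp (⟪p, z⟫ - q ‖z‖² / 2)`. -/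
noncomputable def tilt (p : EuclideanSpace ℝ ι) (q : ℝ) (z : EuclideanSpace ℝ ι) : ℝ :=
  Real.exp (inner ℝ p z - q * ‖z‖ ^ 2 / 2)

/-- The standard Gaussian integral of the weight `tilt p q`. -/
noncomputable def tiltMass (p : EuclideanSpace ℝ ι) (q : ℝ) : ℝ :=
  (√(1 + q))⁻¹ ^ Fintype.card ι * Real.exp (‖p‖ ^ 2 / (2 * (1 + q)))

lemma tilt_toLp (p : EuclideanSpace ℝ ι) (q : ℝ) (x : ι → ℝ) :
    tilt p q (WithLp.toLp 2 x) = ∏ i, Real.exp (p i * x i - q * x i ^ 2 / 2) := by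
  rw [tilt, ← Real.exp_sum, EuclideanSpace.real_norm_sq_eq, PiLp.inner_apply]
  simp [Finset.sum_sub_distrib, Finset.mul_sum, Finset.sum_div, mul_comm]

lemma tiltMass_eq_prod (p : EuclideanSpace ℝ ι) (q : ℝ) :
    tiltMass p q = ∏ i, ((√(1 + q))⁻¹ * Real.exp (p i ^ 2 / (2 * (1 + q)))) := by
  rw [tiltMass, Finset.prod_mul_distrib, ← Real.exp_sum, EuclideanSpace.real_norm_sq_eq,
    Finset.sum_div, Finset.prod_const, Finset.card_univ]

lemma continuous_tilt (p : EuclideanSpace ℝ ι) (q : ℝ) : Continuous (tilt p q) := by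
  unfold tilt
  fun_prop

lemma integral_tilt {q : ℝ} (hq : 0 < 1 + q) (p : EuclideanSpace ℝ ι) :
    ∫ z, tilt p q z ∂(stdGaussian (EuclideanSpace ℝ ι)) = tiltMass p q := by
  rw [← map_pi_eq_stdGaussian, integral_map (by fun_prop)
    (continuous_tilt p q).aestronglyMeasurable]
  simp_rw [tilt_toLp]
  rw [integral_fintype_prod_eq_prod (fun i (x : ℝ) => Real.exp (p i * x - q * x ^ 2 / 2)),
    tiltMass_eq_prod]
  refine Finset.prod_congr rfl fun i _ => ?_
  simpa using integral_exp_tilt_mul_gaussianReal hq (p i) fun _ => 1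

lemma integrable_tilt {q : ℝ} (hq : 0 < 1 + q) (p : EuclideanSpace ℝ ι) :
    Integrable (tilt p q) (stdGaussian (EuclideanSpace ℝ ι)) := by
  rw [← map_pi_eq_stdGaussian, integrable_map_measure
    (continuous_tilt p q).aestronglyMeasurable (by fun_prop)]
  simp only [Function.comp_def, tilt_toLp]
  refine Integrable.fintype_prod (f := fun i (x : ℝ) => Real.exp (p i * x - q * x ^ 2 / 2))
    fun i => ?_
  simpa using integrable_exp_tilt_mul_gaussianReal hq (p i) (fun _ => 1) (integrable_const _)

lemma tilt_toLp_mul_eval (p : EuclideanSpace ℝ ι) (q : ℝ) (k : ι) (x : ι → ℝ) [DecidableEq ι] :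
    tilt p q (WithLp.toLp 2 x) * x k =
      ∏ i, Real.exp (p i * x i - q * x i ^ 2 / 2) * (if i = k then x i else 1) := by
  rw [tilt_toLp, Finset.prod_mul_distrib]
  simp

lemma integrable_tilt_smul_id {q : ℝ} (hq : 0 < 1 + q) (p : EuclideanSpace ℝ ι) :
    Integrable (fun z => tilt p q z • z) (stdGaussian (EuclideanSpace ℝ ι)) := by
  classical
  refine Integrable.of_eval_piLp fun k => ?_
  have hm : Continuous fun z : EuclideanSpace ℝ ι => (tilt p q z • z).ofLp k := by
    have := continuous_tilt p q
    simp only [PiLp.smul_apply]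
    fun_prop
  rw [← map_pi_eq_stdGaussian, integrable_map_measure hm.aestronglyMeasurable (by fun_prop)]
  simp only [Function.comp_def, PiLp.smul_apply, smul_eq_mul, tilt_toLp_mul_eval]
  refine Integrable.fintype_prod
    (f := fun i (x : ℝ) => Real.exp (p i * x - q * x ^ 2 / 2) * (if i = k then x else 1))
    fun i => integrable_exp_tilt_mul_gaussianReal hq (p i) _ ?_
  split_ifs
  · exact IsGaussian.integrable_id
  · exact integrable_const _

lemma integral_tilt_smul_id {q : ℝ} (hq : 0 < 1 + q) (p : EuclideanSpace ℝ ι) :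
    ∫ z, tilt p q z • z ∂(stdGaussian (EuclideanSpace ℝ ι)) =
      (tiltMass p q / (1 + q)) • p := by
  classical
  ext k
  rw [eval_integral_piLp fun i => (integrable_tilt_smul_id hq p).eval_piLp i]
  have hm : Continuous fun z : EuclideanSpace ℝ ι => (tilt p q z • z).ofLp k := by
    have := continuous_tilt p q
    simp only [PiLp.smul_apply]
    fun_prop
  rw [← map_pi_eq_stdGaussian, integral_map (by fun_prop) hm.aestronglyMeasurable]
  simp only [PiLp.smul_apply, smul_eq_mul, tilt_toLp_mul_eval]
  rw [integral_fintype_prod_eq_prod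
    (fun i (x : ℝ) => Real.exp (p i * x - q * x ^ 2 / 2) * (if i = k then x else 1))]
  have h : ∀ i, ∫ x, Real.exp (p i * x - q * x ^ 2 / 2) * (if i = k then x else 1)
      ∂(gaussianReal 0 1) = ((√(1 + q))⁻¹ * Real.exp (p i ^ 2 / (2 * (1 + q)))) *
        if i = k then p i / (1 + q) else 1 := by
    intro i
    rw [integral_exp_tilt_mul_gaussianReal hq (p i) fun x => if i = k then x else 1]
    split_ifs <;> simp
  simp_rw [h]
  rw [Finset.prod_mul_distrib, ← tiltMass_eq_prod]
  simp only [Finset.prod_ite_eq', Finset.mem_univ, if_true]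
  ring

end Tilt

/-! ### A single block -/

section Block

variable {n k : ℕ} (X : Matrix (Fin n) (Fin k) ℝ)

/-- The contribution `X β` of one block to the linear predictor. -/
def blockPred (β : EuclideanSpace ℝ (Fin k)) : EuclideanSpace ℝ (Fin n) :=
  WithLp.toLp 2 (X *ᵥ β.ofLp)

/-- The least squares estimator `(XᵀX)⁻¹ Xᵀ y`. -/
noncomputable def ols (y : EuclideanSpace ℝ (Fin n)) : EuclideanSpace ℝ (Fin k) :=
  WithLp.toLp 2 ((Xᵀ * X)⁻¹ *ᵥ (Xᵀ *ᵥ y.ofLp))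

/-- The squared norm `yᵀ X (XᵀX)⁻¹ Xᵀ y` of the projection of `y` to the column space of `X`. -/
noncomputable def hatQuad (y : EuclideanSpace ℝ (Fin n)) : ℝ :=
  (Xᵀ *ᵥ y.ofLp) ⬝ᵥ ((Xᵀ * X)⁻¹ *ᵥ (Xᵀ *ᵥ y.ofLp))

/-- The factor contributed by one block to the Gaussian likelihood with orthogonal blocks. -/
noncomputable def blockLik (σ : ℝ) (y : EuclideanSpace ℝ (Fin n))
    (β : EuclideanSpace ℝ (Fin k)) : ℝ :=
  Real.exp ((2 * inner ℝ y (blockPred X β) - ‖blockPred X β‖ ^ 2) / (2 * σ ^ 2))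

/-- The marginal weight of `l = λ²` in one block: the integral of `blockLik` against
`N(0, l σ² τ² (XᵀX)⁻¹)`. -/
noncomputable def blockWeight (σ τ : ℝ) (y : EuclideanSpace ℝ (Fin n)) (l : ℝ) : ℝ :=
  (√(1 + l * τ ^ 2))⁻¹ ^ k * Real.exp ((1 - kappa τ l) * (hatQuad X y / (2 * σ ^ 2)))

variable {X}

lemma gram_posDef_of_rank (h : X.rank = k) : (Xᵀ * X).PosDef := by
  have hinj : Function.Injective X.mulVec := by
    have h1 := X.mulVecLin.finrank_range_add_finrank_ker
    have h2 : Module.finrank ℝ (LinearMap.range X.mulVecLin) = k := h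
    rw [h2, Module.finrank_fin_fun] at h1
    have h3 : LinearMap.ker X.mulVecLin = ⊥ := Submodule.finrank_eq_zero.mp (by omega)
    exact LinearMap.ker_eq_bot.mp h3
  simpa using Matrix.PosDef.conjTranspose_mul_self X hinj

lemma hatQuad_nonneg (h : (Xᵀ * X).PosDef) (y : EuclideanSpace ℝ (Fin n)) :
    0 ≤ hatQuad X y := by
  simpa [hatQuad] using h.inv.posSemidef.dotProduct_mulVec_nonneg (Xᵀ *ᵥ y.ofLp)

lemma continuous_blockPred : Continuous (blockPred X) := by
  unfold blockPred
  fun_prop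

lemma continuous_blockLik (σ : ℝ) (y : EuclideanSpace ℝ (Fin n)) :
    Continuous (blockLik X σ y) := by
  have := continuous_blockPred (X := X)
  unfold blockLik
  fun_prop

section Sqrt

open scoped MatrixOrder

lemma sqrt_transpose {S : Matrix (Fin k) (Fin k) ℝ} :
    (CFC.sqrt S)ᵀ = CFC.sqrt S := by
  have := (CFC.sqrt_nonneg S).isSelfAdjoint.star_eq
  simpa [Matrix.star_eq_conjTranspose] using this

/-- A symmetric square root of `v (XᵀX)⁻¹` conjugates `XᵀX` to `v I`. -/
lemma sqrt_mul_gram_mul_sqrt (h : (Xᵀ * X).PosDef) {v : ℝ} (hv : 0 < v) :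
    CFC.sqrt (v • (Xᵀ * X)⁻¹) * (Xᵀ * X) * CFC.sqrt (v • (Xᵀ * X)⁻¹) = v • 1 := by
  have hS : (v • (Xᵀ * X)⁻¹).PosSemidef := h.inv.posSemidef.smul hv.le
  have hA := CFC.sqrt_mul_sqrt_self _ hS.nonneg
  set A := CFC.sqrt (v • (Xᵀ * X)⁻¹)
  have hdet : IsUnit (Xᵀ * X).det := h.det_pos.ne'.isUnit
  have h1 : A * (A * (v⁻¹ • (Xᵀ * X))) = 1 := by
    rw [← mul_assoc, hA, Matrix.smul_mul, Matrix.mul_smul, Matrix.nonsing_inv_mul _ hdet,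
      smul_smul, mul_inv_cancel₀ hv.ne', one_smul]
  have h2 := mul_eq_one_comm.mp h1
  rw [Matrix.mul_smul, Matrix.smul_mul] at h2
  rw [← h2, smul_smul, mul_inv_cancel₀ hv.ne', one_smul]

lemma sqrt_mulVec_dotProduct_self (h : (Xᵀ * X).PosDef) {v : ℝ} (hv : 0 ≤ v)
    (w : Fin k → ℝ) :
    (CFC.sqrt (v • (Xᵀ * X)⁻¹) *ᵥ w) ⬝ᵥ (CFC.sqrt (v • (Xᵀ * X)⁻¹) *ᵥ w) =
      v * (w ⬝ᵥ ((Xᵀ * X)⁻¹ *ᵥ w)) := by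
  have hS : (v • (Xᵀ * X)⁻¹).PosSemidef := h.inv.posSemidef.smul hv
  have hA := CFC.sqrt_mul_sqrt_self _ hS.nonneg
  have hT := sqrt_transpose (S := v • (Xᵀ * X)⁻¹)
  set A := CFC.sqrt (v • (Xᵀ * X)⁻¹)
  nth_rewrite 1 [← hT]
  rw [Matrix.mulVec_transpose, ← Matrix.dotProduct_mulVec, Matrix.mulVec_mulVec, hA,
    Matrix.smul_mulVec, dotProduct_smul, smul_eq_mul]

lemma norm_sq_toLp {ι : Type*} [Fintype ι] (w : ι → ℝ) : ‖WithLp.toLp 2 w‖ ^ 2 = w ⬝ᵥ w := by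
  rw [EuclideanSpace.real_norm_sq_eq]
  simp [dotProduct, sq]

/-- In the coordinates `β = S^{1/2} z`, with `S = v (XᵀX)⁻¹`, the block likelihood is an
exponential-quadratic weight. -/
lemma blockLik_sqrt (h : (Xᵀ * X).PosDef) {v : ℝ} (hv : 0 < v) (σ : ℝ)
    (y : EuclideanSpace ℝ (Fin n)) (z : EuclideanSpace ℝ (Fin k)) :
    blockLik X σ y (Matrix.toEuclideanCLM (𝕜 := ℝ) (CFC.sqrt (v • (Xᵀ * X)⁻¹)) z) =
      tilt (WithLp.toLp 2 ((σ ^ 2)⁻¹ • (CFC.sqrt (v • (Xᵀ * X)⁻¹) *ᵥ (Xᵀ *ᵥ y.ofLp))))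
        (v / σ ^ 2) z := by
  have h1 := sqrt_mul_gram_mul_sqrt h hv
  have hT := sqrt_transpose (S := v • (Xᵀ * X)⁻¹)
  set A := CFC.sqrt (v • (Xᵀ * X)⁻¹)
  have h2 : ‖blockPred X (Matrix.toEuclideanCLM (𝕜 := ℝ) A z)‖ ^ 2 = v * ‖z‖ ^ 2 := by
    have hz : ‖z‖ ^ 2 = z.ofLp ⬝ᵥ z.ofLp := norm_sq_toLp z.ofLp
    rw [blockPred, norm_sq_toLp, hz, Matrix.ofLp_toEuclideanCLM, Matrix.mulVec_mulVec,
      Matrix.dotProduct_mulVec, ← Matrix.mulVec_transpose, Matrix.mulVec_mulVec,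
      Matrix.transpose_mul, hT, ← Matrix.mul_assoc, Matrix.mul_assoc A, h1, Matrix.smul_mulVec,
      Matrix.one_mulVec, smul_dotProduct, smul_eq_mul]
  have h3 : inner ℝ y (blockPred X (Matrix.toEuclideanCLM (𝕜 := ℝ) A z)) =
      (A *ᵥ (Xᵀ *ᵥ y.ofLp)) ⬝ᵥ z.ofLp := by
    rw [EuclideanSpace.inner_eq_star_dotProduct, blockPred, Matrix.ofLp_toEuclideanCLM]
    simp only [star_trivial]
    nth_rewrite 2 [← hT]
    rw [Matrix.mulVec_transpose, Matrix.mulVec_transpose, ← Matrix.dotProduct_mulVec,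
      ← Matrix.dotProduct_mulVec, dotProduct_comm]
  rw [blockLik, h2, h3, tilt, EuclideanSpace.inner_eq_star_dotProduct]
  congr 1
  simp only [star_trivial, dotProduct_smul, smul_eq_mul]
  rw [dotProduct_comm z.ofLp]
  by_cases hσ : σ = 0
  · simp [hσ]
  · field_simp

lemma tiltMass_block (h : (Xᵀ * X).PosDef) {σ τ l : ℝ} (hσ : 0 < σ) (hτ : 0 < τ) (hl : 0 < l)
    (y : EuclideanSpace ℝ (Fin n)) :
    tiltMass (WithLp.toLp 2 ((σ ^ 2)⁻¹ •
      (CFC.sqrt ((l * σ ^ 2 * τ ^ 2) • (Xᵀ * X)⁻¹) *ᵥ (Xᵀ *ᵥ y.ofLp))))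
        (l * σ ^ 2 * τ ^ 2 / σ ^ 2) = blockWeight X σ τ y l := by
  have hq : l * σ ^ 2 * τ ^ 2 / σ ^ 2 = l * τ ^ 2 := by field_simp
  rw [tiltMass, hq, norm_sq_toLp, smul_dotProduct, dotProduct_smul,
    sqrt_mulVec_dotProduct_self h (by positivity), blockWeight, Fintype.card_fin]
  congr 2
  rw [kappa, hatQuad]
  simp only [smul_eq_mul]
  have : 1 + l * τ ^ 2 ≠ 0 := by positivity
  field_simp
  ring

lemma integral_blockLik (h : (Xᵀ * X).PosDef) {σ τ l : ℝ} (hσ : 0 < σ) (hτ : 0 < τ)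
    (hl : 0 < l) (y : EuclideanSpace ℝ (Fin n)) :
    ∫ β, blockLik X σ y β ∂(multivariateGaussian 0 ((l * σ ^ 2 * τ ^ 2) • (Xᵀ * X)⁻¹)) =
      blockWeight X σ τ y l := by
  rw [multivariateGaussian, integral_map (by fun_prop)
    (continuous_blockLik σ y).aestronglyMeasurable]
  simp_rw [zero_add, blockLik_sqrt h (by positivity : 0 < l * σ ^ 2 * τ ^ 2)]
  rw [integral_tilt (by positivity), tiltMass_block h hσ hτ hl]

lemma integrable_blockLik (h : (Xᵀ * X).PosDef) {σ τ l : ℝ} (hσ : 0 < σ) (hτ : 0 < τ)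
    (hl : 0 < l) (y : EuclideanSpace ℝ (Fin n)) :
    Integrable (blockLik X σ y)
      (multivariateGaussian 0 ((l * σ ^ 2 * τ ^ 2) • (Xᵀ * X)⁻¹)) := by
  rw [multivariateGaussian, integrable_map_measure
    (continuous_blockLik σ y).aestronglyMeasurable (by fun_prop)]
  simp only [Function.comp_def, zero_add,
    blockLik_sqrt h (by positivity : 0 < l * σ ^ 2 * τ ^ 2)]
  exact integrable_tilt (by positivity) _

lemma integrable_blockLik_smul (h : (Xᵀ * X).PosDef) {σ τ l : ℝ} (hσ : 0 < σ) (hτ : 0 < τ)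
    (hl : 0 < l) (y : EuclideanSpace ℝ (Fin n)) :
    Integrable (fun β => blockLik X σ y β • β)
      (multivariateGaussian 0 ((l * σ ^ 2 * τ ^ 2) • (Xᵀ * X)⁻¹)) := by
  have hc : Continuous fun β => blockLik X σ y β • β := (continuous_blockLik σ y).smul continuous_id
  rw [multivariateGaussian, integrable_map_measure hc.aestronglyMeasurable (by fun_prop)]
  simp only [Function.comp_def, zero_add,
    blockLik_sqrt h (by positivity : 0 < l * σ ^ 2 * τ ^ 2)]
  simp_rw [← map_smul]
  exact ContinuousLinearMap.integrable_comp _ (integrable_tilt_smul_id (by positivity) _)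

/-- Conditionally on `λ²`, the posterior mean of the coefficients of a block is the least squares
estimator shrunk by `1 - κ`. -/
lemma integral_blockLik_smul (h : (Xᵀ * X).PosDef) {σ τ l : ℝ} (hσ : 0 < σ) (hτ : 0 < τ)
    (hl : 0 < l) (y : EuclideanSpace ℝ (Fin n)) :
    ∫ β, blockLik X σ y β • β ∂(multivariateGaussian 0 ((l * σ ^ 2 * τ ^ 2) • (Xᵀ * X)⁻¹)) =
      (blockWeight X σ τ y l * (1 - kappa τ l)) • ols X y := by
  have hc : Continuous fun β => blockLik X σ y β • β := (continuous_blockLik σ y).smul continuous_id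
  have hv : 0 < l * σ ^ 2 * τ ^ 2 := by positivity
  have hS : ((l * σ ^ 2 * τ ^ 2) • (Xᵀ * X)⁻¹).PosSemidef := h.inv.posSemidef.smul hv.le
  have hA := CFC.sqrt_mul_sqrt_self _ hS.nonneg
  rw [multivariateGaussian, integral_map (by fun_prop) hc.aestronglyMeasurable]
  simp_rw [zero_add, blockLik_sqrt h hv, ← map_smul]
  rw [ContinuousLinearMap.integral_comp_comm _ (integrable_tilt_smul_id (by positivity) _),
    integral_tilt_smul_id (by positivity), tiltMass_block h hσ hτ hl, map_smul,
    Matrix.toEuclideanCLM_toLp, Matrix.mulVec_smul, Matrix.mulVec_mulVec, hA,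
    Matrix.smul_mulVec, ols, WithLp.toLp_smul, WithLp.toLp_smul, smul_smul, smul_smul]
  congr 1
  rw [kappa]
  have : 1 + l * τ ^ 2 ≠ 0 := by positivity
  field_simp
  ring

end Sqrt

end Block

/-! ### Integrals of products over independent coordinates -/

section Product

variable {ι : Type*} [Fintype ι] {E : ι → Type*} {mE : ∀ i, MeasurableSpace (E i)}
  {μ : ∀ i, Measure (E i)} [∀ i, SigmaFinite (μ i)]

lemma prod_update_mul [DecidableEq ι] (f : ∀ i, E i → ℝ) (g : ι) (φ : E g → ℝ)
    (x : ∀ i, E i) :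
    ∏ i, Function.update f g (fun b => f g b * φ b) i (x i) = (∏ i, f i (x i)) * φ (x g) := by
  rw [← Finset.mul_prod_erase _ _ (Finset.mem_univ g),
    ← Finset.mul_prod_erase _ (fun i => f i (x i)) (Finset.mem_univ g), Function.update_self]
  have : ∏ i ∈ Finset.univ.erase g, Function.update f g (fun b => f g b * φ b) i (x i) =
      ∏ i ∈ Finset.univ.erase g, f i (x i) :=
    Finset.prod_congr rfl fun i hi => by rw [Function.update_of_ne (Finset.ne_of_mem_erase hi)]
  rw [this]
  ring

/-- Under independence, weighting one coordinate of a product only affects its own factor. -/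
lemma integral_prod_mul_eval (f : ∀ i, E i → ℝ) (g : ι) (φ : E g → ℝ) (c : ℝ)
    (hc : ∫ b, f g b * φ b ∂(μ g) = (∫ b, f g b ∂(μ g)) * c) :
    ∫ x, (∏ i, f i (x i)) * φ (x g) ∂(Measure.pi μ) = (∏ i, ∫ b, f i b ∂(μ i)) * c := by
  classical
  simp_rw [← prod_update_mul f g φ]
  rw [integral_fintype_prod_eq_prod (Function.update f g (fun b => f g b * φ b)),
    ← Finset.mul_prod_erase _ _ (Finset.mem_univ g), Function.update_self, hc,
    ← Finset.mul_prod_erase _ (fun i => ∫ b, f i b ∂(μ i)) (Finset.mem_univ g)]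
  have : ∏ i ∈ Finset.univ.erase g, ∫ b, Function.update f g (fun b => f g b * φ b) i b ∂(μ i) =
      ∏ i ∈ Finset.univ.erase g, ∫ b, f i b ∂(μ i) :=
    Finset.prod_congr rfl fun i hi => by rw [Function.update_of_ne (Finset.ne_of_mem_erase hi)]
  rw [this]
  ring

lemma integrable_prod_mul_eval {f : ∀ i, E i → ℝ} (hf : ∀ i, Integrable (f i) (μ i)) (g : ι)
    {φ : E g → ℝ} (hφ : Integrable (fun b => f g b * φ b) (μ g)) :
    Integrable (fun x => (∏ i, f i (x i)) * φ (x g)) (Measure.pi μ) := by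
  classical
  simp_rw [← prod_update_mul f g φ]
  refine Integrable.fintype_prod_dep fun i => ?_
  obtain rfl | hi := eq_or_ne i g
  · simpa using hφ
  · simpa [Function.update_of_ne hi] using hf i

end Product

/-! ### The local prior and the weights of a block -/

section LocalPrior

variable {a : ℝ} {L : ℝ → ℝ}

lemma prior_density_pos (hL : IsPriorFunction a L) {t : ℝ} (ht : 0 < t) :
    0 < t ^ (-a - 1) * L t :=
  mul_pos (Real.rpow_pos_of_pos ht _) (hL.pos t ht)

lemma prior_mass_pos (hL : IsPriorFunction a L) :
    0 < ∫ u in Set.Ioi (0 : ℝ), u ^ (-a - 1) * L u := by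
  have h0 : 0 ≤ᵐ[volume.restrict (Set.Ioi (0 : ℝ))] fun u => u ^ (-a - 1) * L u :=
    (ae_restrict_iff' measurableSet_Ioi).mpr
      (Eventually.of_forall fun t ht => (prior_density_pos hL ht).le)
  rw [setIntegral_pos_iff_support_of_nonneg_ae h0 hL.integrable]
  have : Function.support (fun u => u ^ (-a - 1) * L u) ∩ Set.Ioi (0 : ℝ) = Set.Ioi 0 :=
    Set.inter_eq_right.mpr fun t ht => (prior_density_pos hL ht).ne'
  rw [this]
  simp

lemma measurable_prior_density (hL : IsPriorFunction a L) :
    Measurable fun t : ℝ => t ^ (-a - 1) * L t :=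
  (measurable_id.pow_const _).mul hL.measurable

lemma isProbabilityMeasure_localPrior (hL : IsPriorFunction a L) :
    IsProbabilityMeasure (localPrior a L) := by
  constructor
  have hZ := prior_mass_pos hL
  rw [localPrior, withDensity_apply _ MeasurableSet.univ, Measure.restrict_univ,
    ← ofReal_integral_eq_lintegral_ofReal (hL.integrable.const_mul _), integral_const_mul,
    inv_mul_cancel₀ hZ.ne', ENNReal.ofReal_one]
  exact (ae_restrict_iff' measurableSet_Ioi).mpr
    (Eventually.of_forall fun t ht =>
      mul_nonneg (inv_nonneg.mpr hZ.le) (prior_density_pos hL ht).le)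

lemma ae_pos_localPrior : ∀ᵐ t ∂(localPrior a L), 0 < t :=
  (withDensity_absolutelyContinuous _ _).ae_le (ae_restrict_mem measurableSet_Ioi)

lemma ae_pos_pi_localPrior (hL : IsPriorFunction a L) {ι : Type*} [Fintype ι] :
    ∀ᵐ l ∂(Measure.pi fun _ : ι => localPrior a L), ∀ g, 0 < l g := by
  have := isProbabilityMeasure_localPrior hL
  rw [ae_all_iff]
  intro g
  exact (Measure.quasiMeasurePreserving_eval (μ := fun _ : ι => localPrior a L) g).ae
    ae_pos_localPrior

/-- Integrals against the prior law as Lebesgue integrals. -/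
lemma integral_localPrior (hL : IsPriorFunction a L) (f : ℝ → ℝ) :
    ∫ t, f t ∂(localPrior a L) =
      (∫ u in Set.Ioi (0 : ℝ), u ^ (-a - 1) * L u)⁻¹ *
        ∫ t in Set.Ioi (0 : ℝ), t ^ (-a - 1) * L t * f t := by
  have hZ := prior_mass_pos hL
  rw [localPrior, integral_withDensity_eq_integral_toReal_smul
    ((measurable_prior_density hL).const_mul _).ennreal_ofReal (by simp), ← integral_const_mul]
  refine setIntegral_congr_fun measurableSet_Ioi fun t ht => ?_
  have := (prior_density_pos hL ht).le
  simp only [smul_eq_mul]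
  rw [ENNReal.toReal_ofReal (by positivity)]
  ring

lemma integrable_localPrior_iff (hL : IsPriorFunction a L) {f : ℝ → ℝ} :
    Integrable f (localPrior a L) ↔
      IntegrableOn (fun t => t ^ (-a - 1) * L t * f t) (Set.Ioi 0) := by
  have hZ := prior_mass_pos hL
  rw [localPrior, integrable_withDensity_iff_integrable_smul'
    ((measurable_prior_density hL).const_mul _).ennreal_ofReal (by simp),
    IntegrableOn, ← integrable_const_mul_iff (inv_pos.mpr hZ).ne'.isUnit
      (fun t => t ^ (-a - 1) * L t * f t)]
  refine integrableOn_congr_fun (fun t ht => ?_) measurableSet_Ioi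
  have := (prior_density_pos hL ht).le
  simp only [smul_eq_mul]
  rw [ENNReal.toReal_ofReal (by positivity)]
  ring

end LocalPrior

section Weight

variable {n k : ℕ} {X : Matrix (Fin n) (Fin k) ℝ} {σ τ : ℝ} {y : EuclideanSpace ℝ (Fin n)}

lemma kappa_pos {l : ℝ} (hl : 0 ≤ l) : 0 < kappa τ l := by
  unfold kappa
  positivity

lemma kappa_le_one {l : ℝ} (hl : 0 ≤ l) : kappa τ l ≤ 1 := by
  unfold kappa
  exact div_le_one_of_le₀ (by nlinarith [mul_nonneg hl (sq_nonneg τ)]) (by positivity)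

lemma measurable_kappa : Measurable (kappa τ) := by
  unfold kappa
  fun_prop

lemma measurable_blockWeight : Measurable (blockWeight X σ τ y) := by
  have := measurable_kappa (τ := τ)
  unfold blockWeight
  fun_prop

lemma blockWeight_pos {l : ℝ} (hl : 0 ≤ l) : 0 < blockWeight X σ τ y l := by
  unfold blockWeight
  positivity

lemma inv_sqrt_pow_le_one {x : ℝ} (hx : 0 ≤ x) (k : ℕ) : (√(1 + x))⁻¹ ^ k ≤ 1 :=
  pow_le_one₀ (by positivity) (inv_le_one_of_one_le₀ (Real.one_le_sqrt.mpr (by linarith)))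

lemma blockWeight_le (hX : (Xᵀ * X).PosDef) {l : ℝ} (hl : 0 ≤ l) :
    blockWeight X σ τ y l ≤ Real.exp (hatQuad X y / (2 * σ ^ 2)) := by
  have hq : 0 ≤ hatQuad X y / (2 * σ ^ 2) := div_nonneg (hatQuad_nonneg hX y) (by positivity)
  have h1 := kappa_pos (τ := τ) hl
  calc blockWeight X σ τ y l ≤ 1 * Real.exp (hatQuad X y / (2 * σ ^ 2)) := by
        unfold blockWeight
        gcongr
        · exact inv_sqrt_pow_le_one (by positivity) k
        · nlinarith
    _ = _ := one_mul _

lemma integrable_blockWeight {a : ℝ} {L : ℝ → ℝ} (hL : IsPriorFunction a L)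
    (hX : (Xᵀ * X).PosDef) : Integrable (blockWeight X σ τ y) (localPrior a L) := by
  have := isProbabilityMeasure_localPrior hL
  refine Integrable.of_bound measurable_blockWeight.aestronglyMeasurable
    (Real.exp (hatQuad X y / (2 * σ ^ 2))) ?_
  filter_upwards [ae_pos_localPrior] with l hl
  rw [Real.norm_of_nonneg (blockWeight_pos hl.le).le]
  exact blockWeight_le hX hl.le

lemma integral_blockWeight_pos {a : ℝ} {L : ℝ → ℝ} (hL : IsPriorFunction a L)
    (hX : (Xᵀ * X).PosDef) : 0 < ∫ l, blockWeight X σ τ y l ∂(localPrior a L) := by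
  have := isProbabilityMeasure_localPrior hL
  have h0 : 0 ≤ᵐ[localPrior a L] blockWeight X σ τ y := by
    filter_upwards [ae_pos_localPrior] with l hl using (blockWeight_pos hl.le).le
  rw [integral_pos_iff_support_of_nonneg_ae h0 (integrable_blockWeight hL hX)]
  have : Function.support (blockWeight X σ τ y) =ᵐ[localPrior a L] Set.univ := by
    filter_upwards [ae_pos_localPrior] with l hl
    exact propext (iff_of_true (blockWeight_pos hl.le).ne' trivial)
  rw [measure_congr this]
  simp

end Weight

/-! ### Factorisation of the posterior over the groups -/

section Posterior

variable {n G : ℕ} {m : Fin G → ℕ} {X : ∀ g, Matrix (Fin n) (Fin (m g)) ℝ}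

lemma linPred_eq_sum (β : ∀ g, EuclideanSpace ℝ (Fin (m g))) :
    linPred X β = ∑ g, blockPred (X g) (β g) := rfl

lemma inner_blockPred_eq_zero (hX : IsBlockOrthogonal X) {g h : Fin G} (hgh : g ≠ h)
    (b : EuclideanSpace ℝ (Fin (m g))) (c : EuclideanSpace ℝ (Fin (m h))) :
    inner ℝ (blockPred (X g) b) (blockPred (X h) c) = 0 := by
  rw [EuclideanSpace.inner_eq_star_dotProduct, blockPred, blockPred]
  simp only [star_trivial]
  rw [Matrix.dotProduct_mulVec, ← Matrix.mulVec_transpose, Matrix.mulVec_mulVec, hX g h hgh]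
  simp

lemma norm_sub_linPred_sq (hX : IsBlockOrthogonal X) (y : EuclideanSpace ℝ (Fin n))
    (β : ∀ g, EuclideanSpace ℝ (Fin (m g))) :
    ‖y - linPred X β‖ ^ 2 = ‖y‖ ^ 2 -
      ∑ g, (2 * inner ℝ y (blockPred (X g) (β g)) - ‖blockPred (X g) (β g)‖ ^ 2) := by
  have h1 : ‖linPred X β‖ ^ 2 = ∑ g, ‖blockPred (X g) (β g)‖ ^ 2 := by
    rw [← real_inner_self_eq_norm_sq, linPred_eq_sum, sum_inner]
    refine Finset.sum_congr rfl fun g _ => ?_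
    rw [inner_sum, Finset.sum_eq_single g, real_inner_self_eq_norm_sq]
    · exact fun h _ hgh => inner_blockPred_eq_zero hX hgh.symm _ _
    · simp
  rw [norm_sub_sq_real, h1, linPred_eq_sum, inner_sum, Finset.sum_sub_distrib, Finset.mul_sum]
  ring

/-- The factor of the likelihood that does not depend on the coefficients. -/
noncomputable def baseLik (σ : ℝ) (y : EuclideanSpace ℝ (Fin n)) : ℝ :=
  (2 * Real.pi * σ ^ 2) ^ (-(n : ℝ) / 2) * Real.exp (-‖y‖ ^ 2 / (2 * σ ^ 2))

lemma likelihood_eq_prod (hX : IsBlockOrthogonal X) (σ : ℝ) (y : EuclideanSpace ℝ (Fin n))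
    (β : ∀ g, EuclideanSpace ℝ (Fin (m g))) :
    likelihood X σ y β = baseLik σ y * ∏ g, blockLik (X g) σ y (β g) := by
  simp only [likelihood, baseLik, blockLik]
  rw [norm_sub_linPred_sq hX, ← Real.exp_sum, mul_assoc (_ ^ _) (Real.exp _), ← Real.exp_add, ← Finset.sum_div]
  congr 2
  ring

lemma baseLik_pos {σ : ℝ} (hσ : 0 < σ) (y : EuclideanSpace ℝ (Fin n)) : 0 < baseLik σ y := by
  have := Real.pi_pos
  unfold baseLik
  positivity

variable {σ τ : ℝ}

lemma integral_likelihood (hX : IsBlockOrthogonal X) (hP : ∀ g, ((X g)ᵀ * X g).PosDef)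
    (hσ : 0 < σ) (hτ : 0 < τ) {l : Fin G → ℝ} (hl : ∀ g, 0 < l g)
    (y : EuclideanSpace ℝ (Fin n)) :
    ∫ β, likelihood X σ y β ∂(coefPrior X σ τ l) =
      baseLik σ y * ∏ g, blockWeight (X g) σ τ y (l g) := by
  simp_rw [likelihood_eq_prod hX]
  rw [integral_const_mul, coefPrior, integral_fintype_prod_eq_prod]
  congr 1
  exact Finset.prod_congr rfl fun g _ => integral_blockLik (hP g) hσ hτ (hl g) y

lemma integral_likelihood_smul (hX : IsBlockOrthogonal X) (hP : ∀ g, ((X g)ᵀ * X g).PosDef)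
    (hσ : 0 < σ) (hτ : 0 < τ) {l : Fin G → ℝ} (hl : ∀ g, 0 < l g)
    (y : EuclideanSpace ℝ (Fin n)) (g : Fin G) :
    ∫ β, likelihood X σ y β • β g ∂(coefPrior X σ τ l) =
      (baseLik σ y * ((∏ h, blockWeight (X h) σ τ y (l h)) * (1 - kappa τ (l g)))) •
        ols (X g) y := by
  have hc : ∀ j, Integrable (fun β : ∀ h, EuclideanSpace ℝ (Fin (m h)) =>
      (∏ h, blockLik (X h) σ y (β h)) * β g j) (coefPrior X σ τ l) := fun j =>
    integrable_prod_mul_eval (fun h => integrable_blockLik (hP h) hσ hτ (hl h) y) g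
      (φ := fun b => b j) ((integrable_blockLik_smul (hP g) hσ hτ (hl g) y).eval_piLp j)
  have hi : ∀ j, Integrable (fun β : ∀ h, EuclideanSpace ℝ (Fin (m h)) =>
      (likelihood X σ y β • β g) j) (coefPrior X σ τ l) := fun j => by
    simp only [PiLp.smul_apply, smul_eq_mul, likelihood_eq_prod hX, mul_assoc]
    exact (hc j).const_mul _
  ext j
  rw [eval_integral_piLp hi]
  simp only [PiLp.smul_apply, smul_eq_mul, likelihood_eq_prod hX, mul_assoc]
  rw [integral_const_mul]
  congr 1
  have hb : ∫ b, blockLik (X g) σ y b * b j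
      ∂(multivariateGaussian 0 ((l g * σ ^ 2 * τ ^ 2) • ((X g)ᵀ * X g)⁻¹)) =
      (∫ b, blockLik (X g) σ y b
        ∂(multivariateGaussian 0 ((l g * σ ^ 2 * τ ^ 2) • ((X g)ᵀ * X g)⁻¹))) *
        ((1 - kappa τ (l g)) * ols (X g) y j) := by
    have h1 := congrArg (fun v : EuclideanSpace ℝ (Fin (m g)) => v j)
      (integral_blockLik_smul (hP g) hσ hτ (hl g) y)
    simp only [PiLp.smul_apply, smul_eq_mul] at h1
    rw [eval_integral_piLp
      fun i => (integrable_blockLik_smul (hP g) hσ hτ (hl g) y).eval_piLp i] at h1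
    simp only [PiLp.smul_apply, smul_eq_mul] at h1
    rw [h1, integral_blockLik (hP g) hσ hτ (hl g)]
    ring
  rw [coefPrior, integral_prod_mul_eval (fun h => blockLik (X h) σ y) g (fun b => b j) _ hb]
  congr 1
  exact Finset.prod_congr rfl fun h _ => integral_blockLik (hP h) hσ hτ (hl h) y

variable {a : ℝ} {L : ℝ → ℝ}

lemma evidence_eq (hL : IsPriorFunction a L) (hX : IsBlockOrthogonal X)
    (hP : ∀ g, ((X g)ᵀ * X g).PosDef) (hσ : 0 < σ) (hτ : 0 < τ)
    (y : EuclideanSpace ℝ (Fin n)) :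
    evidence a L X σ τ y =
      baseLik σ y * ∏ g, ∫ t, blockWeight (X g) σ τ y t ∂(localPrior a L) := by
  have := isProbabilityMeasure_localPrior hL
  rw [evidence, ← integral_fintype_prod_eq_prod, ← integral_const_mul]
  refine integral_congr_ae ?_
  filter_upwards [ae_pos_pi_localPrior hL] with l hl
  exact integral_likelihood hX hP hσ hτ hl y

lemma evidence_pos (hL : IsPriorFunction a L) (hX : IsBlockOrthogonal X)
    (hP : ∀ g, ((X g)ᵀ * X g).PosDef) (hσ : 0 < σ) (hτ : 0 < τ)
    (y : EuclideanSpace ℝ (Fin n)) : 0 < evidence a L X σ τ y := by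
  rw [evidence_eq hL hX hP hσ hτ]
  exact mul_pos (baseLik_pos hσ y) (Finset.prod_pos fun g _ => integral_blockWeight_pos hL (hP g))

/-- The posterior of `λ_g²` depends on the data of its own block only, so that the posterior
shrinkage factor is a ratio of one-dimensional integrals. -/
lemma shrinkFactor_eq (hL : IsPriorFunction a L) (hX : IsBlockOrthogonal X)
    (hP : ∀ g, ((X g)ᵀ * X g).PosDef) (hσ : 0 < σ) (hτ : 0 < τ)
    (y : EuclideanSpace ℝ (Fin n)) (g : Fin G) :
    shrinkFactor a L X σ τ y g =
      (∫ t, blockWeight (X g) σ τ y t * (1 - kappa τ t) ∂(localPrior a L)) /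
        ∫ t, blockWeight (X g) σ τ y t ∂(localPrior a L) := by
  have := isProbabilityMeasure_localPrior hL
  have hD := integral_blockWeight_pos (σ := σ) (τ := τ) (y := y) hL (hP g)
  have he := evidence_pos hL hX hP hσ hτ y
  have h1 : ∫ l, ∫ β, likelihood X σ y β • (1 - kappa τ (l g)) ∂(coefPrior X σ τ l)
      ∂(Measure.pi fun _ : Fin G => localPrior a L) =
      ∫ l, baseLik σ y * ((∏ h, blockWeight (X h) σ τ y (l h)) * (1 - kappa τ (l g)))
        ∂(Measure.pi fun _ : Fin G => localPrior a L) := by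
    refine integral_congr_ae ?_
    filter_upwards [ae_pos_pi_localPrior hL] with l hl
    rw [integral_smul_const, integral_likelihood hX hP hσ hτ hl, smul_eq_mul, mul_assoc]
  rw [shrinkFactor, posteriorExp, h1, integral_const_mul, integral_prod_mul_eval
    (fun h t => blockWeight (X h) σ τ y t) g (fun t => 1 - kappa τ t)
    ((∫ t, blockWeight (X g) σ τ y t * (1 - kappa τ t) ∂(localPrior a L)) /
        ∫ t, blockWeight (X g) σ τ y t ∂(localPrior a L)) (by field_simp), ← mul_assoc,
    ← evidence_eq hL hX hP hσ hτ, smul_eq_mul, inv_mul_cancel_left₀ he.ne']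

/-- The posterior mean of `β_g` is the least squares estimator times the shrinkage factor. -/
lemma postMean_eq (hL : IsPriorFunction a L) (hX : IsBlockOrthogonal X)
    (hP : ∀ g, ((X g)ᵀ * X g).PosDef) (hσ : 0 < σ) (hτ : 0 < τ)
    (y : EuclideanSpace ℝ (Fin n)) (g : Fin G) :
    postMean a L X σ τ y g = shrinkFactor a L X σ τ y g • ols (X g) y := by
  rw [postMean, shrinkFactor, posteriorExp, posteriorExp, smul_assoc, ← integral_smul_const]
  congr 1
  refine integral_congr_ae ?_
  filter_upwards [ae_pos_pi_localPrior hL] with l hl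
  rw [integral_likelihood_smul hX hP hσ hτ hl, integral_smul_const,
    integral_likelihood hX hP hσ hτ hl, smul_eq_mul, mul_assoc]

end Posterior

/-! ### Bounds for the posterior shrinkage factor -/

section ShrinkBounds

variable {a : ℝ} {L : ℝ → ℝ}

lemma integrable_rpow_localPrior (hL : IsPriorFunction a L) (hLb : IsTailBounded L)
    (ha : 1 / 2 ≤ a) {ρ : ℝ} (hρ0 : 0 < ρ) (hρ : ρ < 1 / 2) :
    Integrable (fun t => t ^ ρ) (localPrior a L) := by
  obtain ⟨-, M, hM⟩ := hLb
  rw [integrable_localPrior_iff hL, ← Set.Ioc_union_Ioi_eq_Ioi zero_le_one]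
  have hmeas : Measurable fun t : ℝ => t ^ (-a - 1) * L t * t ^ ρ :=
    (measurable_prior_density hL).mul (measurable_id.pow_const _)
  refine IntegrableOn.union ?_ ?_
  · refine Integrable.mono' (hL.integrable.mono_set Set.Ioc_subset_Ioi_self)
      hmeas.aestronglyMeasurable ((ae_restrict_iff' measurableSet_Ioc).mpr
        (Eventually.of_forall fun t ht => ?_))
    have hd := prior_density_pos hL ht.1
    rw [norm_mul, Real.norm_of_nonneg hd.le,
      Real.norm_of_nonneg (Real.rpow_nonneg ht.1.le _)]
    exact mul_le_of_le_one_right hd.le (Real.rpow_le_one ht.1.le ht.2 hρ0.le)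
  · refine Integrable.mono' ((integrableOn_Ioi_rpow_of_lt
      (by linarith : -a - 1 + ρ < -1) one_pos).const_mul M)
      hmeas.aestronglyMeasurable ((ae_restrict_iff' measurableSet_Ioi).mpr
        (Eventually.of_forall fun t ht => ?_))
    have ht0 : (0 : ℝ) < t := one_pos.trans ht
    have hd := prior_density_pos hL ht0
    rw [norm_mul, Real.norm_of_nonneg hd.le, Real.norm_of_nonneg (Real.rpow_nonneg ht0.le _),
      Real.rpow_add ht0]
    have := mul_le_mul_of_nonneg_left (hM t ht0)
      (mul_nonneg (Real.rpow_nonneg ht0.le (-a - 1)) (Real.rpow_nonneg ht0.le ρ))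
    linarith

lemma one_sub_kappa_le_rpow {τ l ρ : ℝ} (hτ : 0 < τ) (hl : 0 < l) (hρ0 : 0 < ρ) (hρ : ρ < 1) :
    1 - kappa τ l ≤ τ ^ (2 * ρ) * l ^ ρ := by
  have hx : 0 < l * τ ^ 2 := by positivity
  have h1 : τ ^ (2 * ρ) * l ^ ρ = (l * τ ^ 2) ^ ρ := by
    rw [Real.mul_rpow hl.le (by positivity), Real.rpow_mul hτ.le, mul_comm, Real.rpow_two]
  have h2 : 1 - kappa τ l = l * τ ^ 2 / (1 + l * τ ^ 2) := by
    rw [kappa]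
    field_simp
    ring
  rw [h1, h2]
  generalize l * τ ^ 2 = x at hx
  rcases le_total x 1 with h | h
  · calc x / (1 + x) ≤ x := div_le_self hx.le (by linarith)
      _ = x ^ (1 : ℝ) := (Real.rpow_one x).symm
      _ ≤ x ^ ρ := Real.rpow_le_rpow_of_exponent_ge hx h hρ.le
  · calc x / (1 + x) ≤ 1 := div_le_one_of_le₀ (by linarith) (by linarith)
      _ ≤ x ^ ρ := Real.one_le_rpow h hρ0.le

/-- An upper bound for the posterior shrinkage factor, which forces it below `1 / 2` when the
projected data are of noise size. The moment of order `ρ < 1 / 2 ≤ a` of the local prior is finite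
by the upper bound on `L`. -/
lemma exists_shrink_upper_bound (hL : IsPriorFunction a L) (hLb : IsTailBounded L)
    (ha : 1 / 2 ≤ a) {ρ : ℝ} (hρ0 : 0 < ρ) (hρ : ρ < 1 / 2) (s : ℕ) :
    ∃ C > 0, ∀ {n k : ℕ} (X : Matrix (Fin n) (Fin k) ℝ) (σ τ : ℝ) (y : EuclideanSpace ℝ (Fin n)),
      (Xᵀ * X).PosDef → k ≤ s → 0 < τ → τ ≤ 1 →
      (∫ t, blockWeight X σ τ y t * (1 - kappa τ t) ∂(localPrior a L)) /
        (∫ t, blockWeight X σ τ y t ∂(localPrior a L)) ≤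
        C * τ ^ (2 * ρ) * Real.exp (hatQuad X y / (2 * σ ^ 2)) := by
  have := isProbabilityMeasure_localPrior hL
  have hmom := integrable_rpow_localPrior hL hLb ha hρ0 hρ
  have hlow : Integrable (fun t : ℝ => (√(1 + t))⁻¹ ^ s) (localPrior a L) := by
    refine Integrable.of_bound (Measurable.aestronglyMeasurable (by fun_prop)) 1 ?_
    filter_upwards [ae_pos_localPrior] with t ht
    rw [Real.norm_of_nonneg (by positivity)]
    exact inv_sqrt_pow_le_one ht.le s
  have hd : 0 < ∫ t : ℝ, (√(1 + t))⁻¹ ^ s ∂(localPrior a L) := by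
    have h0 : 0 ≤ᵐ[localPrior a L] fun t : ℝ => (√(1 + t))⁻¹ ^ s :=
      Eventually.of_forall fun t => by positivity
    rw [integral_pos_iff_support_of_nonneg_ae h0 hlow]
    have : Function.support (fun t : ℝ => (√(1 + t))⁻¹ ^ s) =ᵐ[localPrior a L] Set.univ := by
      filter_upwards [ae_pos_localPrior] with t ht
      have : (√(1 + t))⁻¹ ^ s ≠ 0 := by positivity
      exact propext (iff_of_true this trivial)
    rw [measure_congr this]
    simp
  set d := ∫ t : ℝ, (√(1 + t))⁻¹ ^ s ∂(localPrior a L)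
  have hM : 0 ≤ ∫ t, t ^ ρ ∂(localPrior a L) := by
    refine integral_nonneg_of_ae ?_
    filter_upwards [ae_pos_localPrior] with t ht using Real.rpow_nonneg ht.le _
  set M := ∫ t, t ^ ρ ∂(localPrior a L)
  refine ⟨(M + 1) / d, by positivity, fun {n k} X σ τ y hX hk hτ hτ1 => ?_⟩
  have hH : 0 ≤ hatQuad X y / (2 * σ ^ 2) := div_nonneg (hatQuad_nonneg hX y) (by positivity)
  have hD : d ≤ ∫ t, blockWeight X σ τ y t ∂(localPrior a L) := by
    refine integral_mono_ae hlow (integrable_blockWeight hL hX) ?_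
    filter_upwards [ae_pos_localPrior] with t ht
    have hk1 := kappa_le_one (τ := τ) ht.le
    have h1 : 1 ≤ Real.exp ((1 - kappa τ t) * (hatQuad X y / (2 * σ ^ 2))) :=
      Real.one_le_exp (mul_nonneg (by linarith) hH)
    have h2 : (√(1 + t))⁻¹ ^ s ≤ (√(1 + t))⁻¹ ^ k :=
      pow_le_pow_of_le_one (by positivity)
        (inv_le_one_of_one_le₀ (Real.one_le_sqrt.mpr (by linarith))) hk
    have h3 : (√(1 + t))⁻¹ ^ k ≤ (√(1 + t * τ ^ 2))⁻¹ ^ k := by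
      have : t * τ ^ 2 ≤ t := mul_le_of_le_one_right ht.le (pow_le_one₀ hτ.le hτ1)
      gcongr
    unfold blockWeight
    calc (√(1 + t))⁻¹ ^ s ≤ (√(1 + t * τ ^ 2))⁻¹ ^ k * 1 := by linarith
      _ ≤ _ := by gcongr
  have hN : ∫ t, blockWeight X σ τ y t * (1 - kappa τ t) ∂(localPrior a L) ≤
      Real.exp (hatQuad X y / (2 * σ ^ 2)) * τ ^ (2 * ρ) * M := by
    rw [← integral_const_mul]
    refine integral_mono_of_nonneg ?_ (hmom.const_mul _) ?_
    · filter_upwards [ae_pos_localPrior] with t ht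
      exact mul_nonneg (blockWeight_pos ht.le).le (sub_nonneg.mpr (kappa_le_one ht.le))
    · filter_upwards [ae_pos_localPrior] with t ht
      rw [mul_assoc]
      exact mul_le_mul (blockWeight_le hX ht.le)
        (one_sub_kappa_le_rpow hτ ht hρ0 (by linarith))
        (sub_nonneg.mpr (kappa_le_one ht.le)) (Real.exp_pos _).le
  have hτρ : 0 ≤ τ ^ (2 * ρ) := Real.rpow_nonneg hτ.le _
  calc _ ≤ Real.exp (hatQuad X y / (2 * σ ^ 2)) * τ ^ (2 * ρ) * (M + 1) / d := by
        refine div_le_div₀ (by positivity) (hN.trans ?_) hd hD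
        gcongr
        linarith
    _ = _ := by ring

/-- A lower bound for the posterior shrinkage factor, which forces it above `1 / 2` when the
projected data are large. The event `κ > 1 / 4` receives weight at most `exp (3 H / 4)` with
`H = hatQuad X y / (2 σ²)`, while the prior mass of `τ² λ² ∈ [7, 14]`, on which `κ ≤ 1 / 8`, is of
order at least `τ ^ (2 a)` by the lower bound on `L`. -/
lemma exists_shrink_lower_bound (hL : IsPriorFunction a L) (hLb : IsTailBounded L)
    (ha : 1 / 2 ≤ a) (s : ℕ) :
    ∃ C > 0, ∃ τ₁ > 0, ∀ {n k : ℕ} (X : Matrix (Fin n) (Fin k) ℝ) (σ τ : ℝ)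
      (y : EuclideanSpace ℝ (Fin n)), (Xᵀ * X).PosDef → k ≤ s → 0 < τ → τ ≤ τ₁ →
      3 / 4 - C * τ ^ (-(2 * a)) * Real.exp (-(hatQuad X y / (2 * σ ^ 2)) / 8) ≤
      (∫ t, blockWeight X σ τ y t * (1 - kappa τ t) ∂(localPrior a L)) /
        (∫ t, blockWeight X σ τ y t ∂(localPrior a L)) := by
  have := isProbabilityMeasure_localPrior hL
  obtain ⟨⟨c₀, hc₀, t₀, ht₀, hLt⟩, -⟩ := hLb
  have hZ := prior_mass_pos hL
  set Z := ∫ u in Set.Ioi (0 : ℝ), u ^ (-a - 1) * L u with hZdef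
  refine ⟨√15 ^ s * Z * c₀⁻¹ * 14 ^ (a + 1) / 7, by positivity, √(7 / t₀), by positivity,
    fun {n k} X σ τ y hX hk hτ hτ1 => ?_⟩
  have hH : 0 ≤ hatQuad X y / (2 * σ ^ 2) := div_nonneg (hatQuad_nonneg hX y) (by positivity)
  have hD := integral_blockWeight_pos (σ := σ) (τ := τ) (y := y) hL hX
  have hWi := integrable_blockWeight (σ := σ) (τ := τ) (y := y) hL hX
  set H := hatQuad X y / (2 * σ ^ 2) with hHdef
  have hWκ : Integrable (fun t => blockWeight X σ τ y t * kappa τ t) (localPrior a L) := by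
    refine hWi.mul_bdd (c := 1) measurable_kappa.aestronglyMeasurable ?_
    filter_upwards [ae_pos_localPrior] with t ht
    rw [Real.norm_of_nonneg (kappa_pos ht.le).le]
    exact kappa_le_one ht.le
  have hN : ∫ t, blockWeight X σ τ y t * (1 - kappa τ t) ∂(localPrior a L) =
      ∫ t, blockWeight X σ τ y t ∂(localPrior a L) -
        ∫ t, blockWeight X σ τ y t * kappa τ t ∂(localPrior a L) := by
    simp_rw [mul_sub, mul_one]
    exact integral_sub hWi hWκ
  have hκ : ∫ t, blockWeight X σ τ y t * kappa τ t ∂(localPrior a L) ≤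
      1 / 4 * ∫ t, blockWeight X σ τ y t ∂(localPrior a L) + Real.exp (3 / 4 * H) := by
    have h1 : ∫ t, (1 / 4 * blockWeight X σ τ y t + Real.exp (3 / 4 * H)) ∂(localPrior a L) =
        1 / 4 * ∫ t, blockWeight X σ τ y t ∂(localPrior a L) + Real.exp (3 / 4 * H) := by
      rw [integral_add (hWi.const_mul _) (integrable_const _), integral_const_mul]
      simp
    rw [← h1]
    refine integral_mono_ae hWκ ((hWi.const_mul _).add (integrable_const _)) ?_
    filter_upwards [ae_pos_localPrior] with t ht
    have hW := blockWeight_pos (X := X) (σ := σ) (τ := τ) (y := y) ht.le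
    have hk0 := kappa_pos (τ := τ) ht.le
    have hk1 := kappa_le_one (τ := τ) ht.le
    rcases le_total (kappa τ t) (1 / 4) with h | h
    · have := Real.exp_pos (3 / 4 * H)
      nlinarith
    · have h2 : blockWeight X σ τ y t ≤ 1 * Real.exp (3 / 4 * H) := by
        unfold blockWeight
        gcongr
        · exact inv_sqrt_pow_le_one (by positivity) k
        · linarith
      nlinarith
  have hT : t₀ ≤ 7 / τ ^ 2 := by
    have h1 : τ ^ 2 ≤ 7 / t₀ := (Real.le_sqrt hτ.le (by positivity)).mp hτ1
    rw [le_div_iff₀ (by positivity)] at h1 ⊢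
    linarith
  have hDlow : Z⁻¹ * (7 / τ ^ 2 * ((14 / τ ^ 2) ^ (-a - 1) * c₀ *
      ((√15)⁻¹ ^ s * Real.exp (7 / 8 * H)))) ≤
      ∫ t, blockWeight X σ τ y t ∂(localPrior a L) := by
    rw [integral_localPrior hL, ← hZdef]
    have hT0 : 0 < 7 / τ ^ 2 := by positivity
    have hsub : Set.Icc (7 / τ ^ 2) (14 / τ ^ 2) ⊆ Set.Ioi (0 : ℝ) := fun t ht =>
      hT0.trans_le ht.1
    have hint := (integrable_localPrior_iff hL).mp hWi
    have hvol : (volume : Measure ℝ).real (Set.Icc (7 / τ ^ 2) (14 / τ ^ 2)) = 7 / τ ^ 2 := by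
      rw [Real.volume_real_Icc_of_le (by gcongr; norm_num)]
      ring
    refine mul_le_mul_of_nonneg_left ?_ (inv_nonneg.mpr hZ.le)
    calc _ = ∫ t in Set.Icc (7 / τ ^ 2) (14 / τ ^ 2), (14 / τ ^ 2) ^ (-a - 1) * c₀ *
          ((√15)⁻¹ ^ s * Real.exp (7 / 8 * H)) := by
          rw [setIntegral_const, hvol, smul_eq_mul]
      _ ≤ ∫ t in Set.Icc (7 / τ ^ 2) (14 / τ ^ 2),
          t ^ (-a - 1) * L t * blockWeight X σ τ y t := by
          refine setIntegral_mono_on continuous_const.integrableOn_Icc (hint.mono_set hsub) measurableSet_Icc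
            fun t ht => ?_
          have ht0 : 0 < t := hsub ht
          have h7 : 7 ≤ t * τ ^ 2 := by
            have := ht.1
            rwa [div_le_iff₀ (by positivity)] at this
          have h14 : t * τ ^ 2 ≤ 14 := by
            have := ht.2
            rwa [le_div_iff₀ (by positivity)] at this
          have e1 : (14 / τ ^ 2) ^ (-a - 1) ≤ t ^ (-a - 1) :=
            Real.rpow_le_rpow_of_nonpos ht0 ht.2 (by linarith)
          have e2 : c₀ ≤ L t := hLt t (hT.trans ht.1)
          have e3 : (√15)⁻¹ ^ s ≤ (√(1 + t * τ ^ 2))⁻¹ ^ k := by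
            have h15 : (√15)⁻¹ ≤ 1 :=
              inv_le_one_of_one_le₀ (Real.one_le_sqrt.mpr (by norm_num))
            calc (√15)⁻¹ ^ s ≤ (√15)⁻¹ ^ k := pow_le_pow_of_le_one (by positivity) h15 hk
              _ ≤ _ := by
                gcongr
                linarith
          have e4 : kappa τ t ≤ 1 / 8 := by
            unfold kappa
            gcongr
            linarith
          have e5 : 7 / 8 * H ≤ (1 - kappa τ t) * H := by nlinarith
          unfold blockWeight
          have := (prior_density_pos hL ht0).le
          gcongr
      _ ≤ _ := by
          refine setIntegral_mono_set hint ?_ hsub.eventuallyLE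
          exact (ae_restrict_iff' measurableSet_Ioi).mpr (Eventually.of_forall fun t ht =>
            mul_nonneg (prior_density_pos hL ht).le (blockWeight_pos (le_of_lt ht)).le)
  set D := ∫ t, blockWeight X σ τ y t ∂(localPrior a L)
  have hkey : Real.exp (3 / 4 * H) / D ≤
      √15 ^ s * Z * c₀⁻¹ * 14 ^ (a + 1) / 7 * τ ^ (-(2 * a)) * Real.exp (-H / 8) := by
    have hexp : Real.exp (3 / 4 * H) = Real.exp (7 / 8 * H) * Real.exp (-H / 8) := by
      rw [← Real.exp_add]
      ring_nf
    have hpow : (14 / τ ^ 2) ^ (-a - 1) = (14 ^ (a + 1))⁻¹ * (τ ^ (2 * a) * τ ^ 2) := by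
      rw [Real.div_rpow (by norm_num) (by positivity), show -a - 1 = -(a + 1) by ring,
        Real.rpow_neg (by norm_num), Real.rpow_neg (by positivity), ← Real.rpow_two,
        ← Real.rpow_mul hτ.le, ← Real.rpow_add hτ, div_eq_mul_inv, inv_inv]
      ring_nf
    rw [div_le_iff₀ hD]
    refine le_trans ?_ (mul_le_mul_of_nonneg_left hDlow (by positivity))
    rw [hexp, hpow, Real.rpow_neg hτ.le]
    have hτa : 0 < τ ^ (2 * a) := Real.rpow_pos_of_pos hτ _
    have h14 : (0 : ℝ) < 14 ^ (a + 1) := by positivity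
    rw [inv_pow]
    field_simp
    exact le_refl _
  rw [hN, sub_div, div_self hD.ne']
  have : (∫ t, blockWeight X σ τ y t * kappa τ t ∂(localPrior a L)) / D ≤
      1 / 4 + Real.exp (3 / 4 * H) / D := by
    calc _ ≤ (1 / 4 * D + Real.exp (3 / 4 * H)) / D := by gcongr
      _ = _ := by field_simp
  linarith

end ShrinkBounds

/-! ### Gaussian tails of the projected data -/

section Tails

open scoped MatrixOrder

variable {n k : ℕ}

/-- The transpose of a matrix with orthonormal columns maps the standard Gaussian law to the
standard Gaussian law. -/
lemma map_transpose_stdGaussian {B : Matrix (Fin n) (Fin k) ℝ} (hB : Bᵀ * B = 1) :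
    (stdGaussian (EuclideanSpace ℝ (Fin n))).map (fun z => WithLp.toLp 2 (Bᵀ *ᵥ z.ofLp)) =
      stdGaussian (EuclideanSpace ℝ (Fin k)) := by
  have hc : Continuous fun z : EuclideanSpace ℝ (Fin n) =>
      (WithLp.toLp 2 (Bᵀ *ᵥ z.ofLp) : EuclideanSpace ℝ (Fin k)) := by fun_prop
  have : IsProbabilityMeasure ((stdGaussian (EuclideanSpace ℝ (Fin n))).map
      fun z => (WithLp.toLp 2 (Bᵀ *ᵥ z.ofLp) : EuclideanSpace ℝ (Fin k))) :=
    Measure.isProbabilityMeasure_map hc.aemeasurable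
  refine Measure.ext_of_charFun ?_
  ext t
  rw [charFun_stdGaussian, charFun_apply, integral_map hc.aemeasurable (by fun_prop)]
  have h1 : ∀ z : EuclideanSpace ℝ (Fin n),
      inner ℝ (WithLp.toLp 2 (Bᵀ *ᵥ z.ofLp) : EuclideanSpace ℝ (Fin k)) t =
        inner ℝ z (blockPred B t) := by
    intro z
    rw [EuclideanSpace.inner_eq_star_dotProduct, EuclideanSpace.inner_eq_star_dotProduct,
      blockPred]
    simp only [star_trivial]
    rw [Matrix.mulVec_transpose, dotProduct_comm, ← Matrix.dotProduct_mulVec, dotProduct_comm]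
  have h2 : ‖blockPred B t‖ = ‖t‖ := by
    have h3 : ‖blockPred B t‖ ^ 2 = ‖t‖ ^ 2 := by
      have ht : ‖t‖ ^ 2 = t.ofLp ⬝ᵥ t.ofLp := norm_sq_toLp t.ofLp
      rw [blockPred, norm_sq_toLp, ht, Matrix.dotProduct_mulVec, ← Matrix.mulVec_transpose,
        Matrix.mulVec_mulVec, hB, Matrix.one_mulVec]
    exact (sq_eq_sq₀ (norm_nonneg _) (norm_nonneg _)).mp h3
  simp_rw [h1]
  rw [← charFun_apply, charFun_stdGaussian, h2]

/-- Coordinates of the projection to the column space of `X` in an orthonormal basis of it. -/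
noncomputable def colCoord (X : Matrix (Fin n) (Fin k) ℝ) (y : EuclideanSpace ℝ (Fin n)) :
    EuclideanSpace ℝ (Fin k) :=
  WithLp.toLp 2 (CFC.sqrt ((1 : ℝ) • (Xᵀ * X)⁻¹) *ᵥ (Xᵀ *ᵥ y.ofLp))

variable {X : Matrix (Fin n) (Fin k) ℝ}

lemma norm_colCoord_sq (hX : (Xᵀ * X).PosDef) (y : EuclideanSpace ℝ (Fin n)) :
    ‖colCoord X y‖ ^ 2 = hatQuad X y := by
  rw [colCoord, norm_sq_toLp, sqrt_mulVec_dotProduct_self hX zero_le_one, one_mul, hatQuad]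

lemma colCoord_add_smul (y z : EuclideanSpace ℝ (Fin n)) (σ : ℝ) :
    colCoord X (y + σ • z) = colCoord X y + σ • colCoord X z := by
  simp [colCoord, Matrix.mulVec_add, Matrix.mulVec_smul]

lemma map_colCoord_stdGaussian (hX : (Xᵀ * X).PosDef) :
    (stdGaussian (EuclideanSpace ℝ (Fin n))).map (colCoord X) =
      stdGaussian (EuclideanSpace ℝ (Fin k)) := by
  have hT := sqrt_transpose (S := (1 : ℝ) • (Xᵀ * X)⁻¹)
  have h1 := sqrt_mul_gram_mul_sqrt hX one_pos
  have hB : (X * CFC.sqrt ((1 : ℝ) • (Xᵀ * X)⁻¹))ᵀ * (X * CFC.sqrt ((1 : ℝ) • (Xᵀ * X)⁻¹)) =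
      1 := by
    rw [Matrix.transpose_mul, hT, Matrix.mul_assoc, ← Matrix.mul_assoc Xᵀ, ← Matrix.mul_assoc, h1,
      one_smul]
  rw [← map_transpose_stdGaussian hB]
  congr 1
  ext z : 1
  rw [colCoord, Matrix.transpose_mul, hT, Matrix.mulVec_mulVec]

lemma continuous_colCoord : Continuous (colCoord X) := by
  unfold colCoord
  fun_prop

/-- The chi-square tail bound obtained from the exponential moment of order `θ / 2`. -/
lemma stdGaussian_hatQuad_ge_le (hX : (Xᵀ * X).PosDef) {θ : ℝ} (hθ0 : 0 < θ) (hθ : θ < 1)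
    (x : ℝ) :
    (stdGaussian (EuclideanSpace ℝ (Fin n))).real {z | x ≤ hatQuad X z} ≤
      (√(1 - θ))⁻¹ ^ k * Real.exp (-(θ * x / 2)) := by
  have hq : 0 < 1 + -θ := by linarith
  have hm := mul_meas_ge_le_integral_of_nonneg
    (μ := stdGaussian (EuclideanSpace ℝ (Fin k))) (f := tilt 0 (-θ))
    (Eventually.of_forall fun _ => (Real.exp_pos _).le) (integrable_tilt hq 0)
    (Real.exp (θ * x / 2))
  rw [integral_tilt hq] at hm
  have hset : {z : EuclideanSpace ℝ (Fin n) | x ≤ hatQuad X z} =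
      colCoord X ⁻¹' {w | Real.exp (θ * x / 2) ≤ tilt 0 (-θ) w} := by
    ext z
    have h0 : inner ℝ (0 : EuclideanSpace ℝ (Fin k)) (colCoord X z) -
        -θ * ‖colCoord X z‖ ^ 2 / 2 = θ * hatQuad X z / 2 := by
      rw [norm_colCoord_sq hX, inner_zero_left]
      ring
    simp only [Set.mem_ofPred_eq, Set.mem_preimage, tilt, Real.exp_le_exp, h0]
    constructor <;> intro h <;> nlinarith
  have hms : MeasurableSet {w : EuclideanSpace ℝ (Fin k) |
      Real.exp (θ * x / 2) ≤ tilt 0 (-θ) w} :=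
    measurableSet_le measurable_const (continuous_tilt 0 (-θ)).measurable
  rw [hset, ← map_measureReal_apply continuous_colCoord.measurable hms,
    map_colCoord_stdGaussian hX, Real.exp_neg, ← div_eq_mul_inv,
    le_div_iff₀ (Real.exp_pos _), mul_comm]
  refine hm.trans (le_of_eq ?_)
  simp [tiltMass, ← sub_eq_add_neg]

lemma sqrt_sq_smul_one {σ : ℝ} (hσ : 0 < σ) :
    CFC.sqrt (σ ^ 2 • (1 : Matrix (Fin n) (Fin n) ℝ)) = σ • 1 := by
  refine CFC.sqrt_unique ?_ ?_
  · rw [Matrix.smul_mul, Matrix.mul_smul, one_mul, smul_smul, sq]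
  · exact (Matrix.PosSemidef.one.smul hσ.le).nonneg

/-- The data are the linear predictor plus `σ` times standard Gaussian noise. -/
lemma dataLaw_eq_map {G : ℕ} {m : Fin G → ℕ} (X : ∀ g, Matrix (Fin n) (Fin (m g)) ℝ)
    {σ : ℝ} (hσ : 0 < σ) (β : ∀ g, EuclideanSpace ℝ (Fin (m g))) :
    dataLaw X σ β =
      (stdGaussian (EuclideanSpace ℝ (Fin n))).map fun z => linPred X β + σ • z := by
  rw [dataLaw, multivariateGaussian, sqrt_sq_smul_one hσ]
  simp

lemma colCoord_linPred {G : ℕ} {m : Fin G → ℕ} {X : ∀ g, Matrix (Fin n) (Fin (m g)) ℝ}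
    (hX : IsBlockOrthogonal X) (β : ∀ g, EuclideanSpace ℝ (Fin (m g))) (g : Fin G) :
    colCoord (X g) (linPred X β) = colCoord (X g) (blockPred (X g) (β g)) := by
  have : (X g)ᵀ *ᵥ (linPred X β).ofLp = (X g)ᵀ *ᵥ (blockPred (X g) (β g)).ofLp := by
    rw [linPred_eq_sum, WithLp.ofLp_sum, Matrix.mulVec_sum, Finset.sum_eq_single g]
    · intro h _ hgh
      rw [blockPred, Matrix.mulVec_mulVec, hX g h hgh.symm, Matrix.zero_mulVec]
    · simp
  rw [colCoord, colCoord, this]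

lemma norm_colCoord_blockPred (hX : (Xᵀ * X).PosDef) (β : EuclideanSpace ℝ (Fin k)) :
    ‖colCoord X (blockPred X β)‖ ^ 2 = ‖blockPred X β‖ ^ 2 := by
  have hdet : IsUnit (Xᵀ * X).det := hX.det_pos.ne'.isUnit
  rw [norm_colCoord_sq hX, hatQuad, blockPred, norm_sq_toLp, Matrix.mulVec_mulVec,
    Matrix.mulVec_mulVec, Matrix.nonsing_inv_mul _ hdet, Matrix.one_mulVec,
    ← Matrix.mulVec_mulVec, Matrix.mulVec_transpose, ← Matrix.dotProduct_mulVec]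

/-- The Rayleigh bound of a quadratic form by the smallest eigenvalue. -/
lemma eMin_mul_le_dotProduct {A : Matrix (Fin k) (Fin k) ℝ} (hA : A.IsHermitian)
    (w : Fin k → ℝ) : eMin A * (w ⬝ᵥ w) ≤ w ⬝ᵥ (A *ᵥ w) := by
  have hfin : (spectrum ℝ A).Finite := A.finite_spectrum
  have hsub : (A - eMin A • 1).IsHermitian := hA.sub (by
    rw [Matrix.IsHermitian, Matrix.conjTranspose_smul, Matrix.conjTranspose_one, star_trivial])
  have hpsd : (A - eMin A • 1).PosSemidef := by
    rw [hsub.posSemidef_iff_eigenvalues_nonneg]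
    intro i
    have hi : hsub.eigenvalues i ∈ spectrum ℝ (A - eMin A • 1) :=
      hsub.eigenvalues_mem_spectrum_real i
    have h1 : hsub.eigenvalues i + eMin A ∈ spectrum ℝ A := by
      rwa [spectrum.add_mem_iff, Algebra.algebraMap_eq_smul_one, neg_add_eq_sub]
    have h3 : eMin A ≤ hsub.eigenvalues i + eMin A := csInf_le hfin.bddBelow h1
    simpa using h3
  have h4 := hpsd.dotProduct_mulVec_nonneg w
  rw [star_trivial, Matrix.sub_mulVec, dotProduct_sub, Matrix.smul_mulVec, Matrix.one_mulVec,
    dotProduct_smul, smul_eq_mul] at h4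
  linarith

end Tails

/-! ### Selection on the event of moderate noise -/

section Selection

variable {n G : ℕ} {m : Fin G → ℕ} {X : ∀ g, Matrix (Fin n) (Fin (m g)) ℝ} {σ : ℝ}

lemma one_sub_sum_le_dataLaw_real (hP : ∀ g, ((X g)ᵀ * X g).PosDef) (hσ : 0 < σ)
    (β : ∀ g, EuclideanSpace ℝ (Fin (m g))) {s : ℕ} (hs : ∀ g, m g ≤ s) {θ : ℝ} (hθ0 : 0 < θ)
    (hθ : θ < 1) (x : Fin G → ℝ) (S : Set (EuclideanSpace ℝ (Fin n)))
    (hS : ∀ z, (∀ g, hatQuad (X g) z < x g) → linPred X β + σ • z ∈ S) :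
    1 - ∑ g, (√(1 - θ))⁻¹ ^ s * Real.exp (-(θ * x g / 2)) ≤ (dataLaw X σ β).real S := by
  set γ := stdGaussian (EuclideanSpace ℝ (Fin n))
  have hf : Measurable fun z : EuclideanSpace ℝ (Fin n) => linPred X β + σ • z := by fun_prop
  have hmeas : MeasurableSet (⋃ g, {z : EuclideanSpace ℝ (Fin n) | x g ≤ hatQuad (X g) z}) := by
    refine MeasurableSet.iUnion fun g => measurableSet_le measurable_const ?_
    exact ((continuous_colCoord.norm.pow 2).congr (norm_colCoord_sq (hP g))).measurable
  have hbad : γ.real (⋃ g, {z | x g ≤ hatQuad (X g) z}) ≤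
      ∑ g, (√(1 - θ))⁻¹ ^ s * Real.exp (-(θ * x g / 2)) := by
    refine (measureReal_iUnion_fintype_le _).trans (Finset.sum_le_sum fun g _ => ?_)
    refine (stdGaussian_hatQuad_ge_le (hP g) hθ0 hθ (x g)).trans ?_
    gcongr
    · refine (one_le_inv₀ (Real.sqrt_pos.mpr (by linarith))).mpr ?_
      exact Real.sqrt_le_one.mpr (by linarith)
    · exact hs g
  have hsub : (⋃ g, {z | x g ≤ hatQuad (X g) z})ᶜ ⊆
      (fun z : EuclideanSpace ℝ (Fin n) => linPred X β + σ • z) ⁻¹' S := by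
    intro z hz
    refine hS z fun g => not_le.mp fun h => hz ?_
    exact Set.mem_iUnion.mpr ⟨g, h⟩
  have h1 : γ.real ((fun z => linPred X β + σ • z) ⁻¹' S) ≤ (dataLaw X σ β).real S := by
    have : IsProbabilityMeasure (γ.map fun z => linPred X β + σ • z) :=
      Measure.isProbabilityMeasure_map hf.aemeasurable
    rw [dataLaw_eq_map X hσ]
    exact ENNReal.toReal_mono (measure_ne_top _ _) (Measure.le_map_apply hf.aemeasurable S)
  have h2 := measureReal_mono (μ := γ) hsub
  rw [probReal_compl_eq_one_sub hmeas] at h2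
  linarith

lemma hatQuad_data_of_inactive (hX : IsBlockOrthogonal X) (hP : ∀ g, ((X g)ᵀ * X g).PosDef)
    (β : ∀ g, EuclideanSpace ℝ (Fin (m g))) {g : Fin G} (hg : β g = 0)
    (z : EuclideanSpace ℝ (Fin n)) :
    hatQuad (X g) (linPred X β + σ • z) = σ ^ 2 * hatQuad (X g) z := by
  have h0 : colCoord (X g) (linPred X β) = 0 := by
    rw [colCoord_linPred hX, hg]
    simp [colCoord, blockPred]
  rw [← norm_colCoord_sq (hP g), ← norm_colCoord_sq (hP g), colCoord_add_smul, h0, zero_add,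
    norm_smul, mul_pow, Real.norm_eq_abs, sq_abs]

lemma signal_le_norm_colCoord (hX : IsBlockOrthogonal X) (hP : ∀ g, ((X g)ᵀ * X g).PosDef)
    (hn : 0 < n) (β : ∀ g, EuclideanSpace ℝ (Fin (m g))) {g : Fin G} (hg : β g ≠ 0)
    {C₁ c b : ℝ} (hC₁ : 0 < C₁) (hc : 0 < c) (h1 : C₁ < eMin (gram X g))
    (h2 : ∀ j, c * (n : ℝ) ^ (-b) < |β g j|) :
    C₁ * c ^ 2 * (n : ℝ) ^ (1 - 2 * b) ≤ ‖colCoord (X g) (linPred X β)‖ ^ 2 := by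
  have hn' : (0 : ℝ) < n := Nat.cast_pos.mpr hn
  obtain ⟨j, -⟩ : ∃ j, β g j ≠ 0 := by
    by_contra! h
    exact hg (by ext j; simpa using h j)
  have hβ : (c * (n : ℝ) ^ (-b)) ^ 2 ≤ (β g).ofLp ⬝ᵥ (β g).ofLp := by
    calc (c * (n : ℝ) ^ (-b)) ^ 2 ≤ |β g j| ^ 2 := by
          have := (h2 j).le
          gcongr
      _ = β g j * β g j := by rw [sq_abs, sq]
      _ ≤ _ := Finset.single_le_sum (f := fun i => β g i * β g i)
          (fun i _ => mul_self_nonneg _) (Finset.mem_univ j)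
  have hherm : (gram X g).IsHermitian := by
    rw [gram, Matrix.IsHermitian, Matrix.conjTranspose_smul, (hP g).isHermitian.eq, star_trivial]
  have hray := eMin_mul_le_dotProduct hherm (β g).ofLp
  have hgram : ‖blockPred (X g) (β g)‖ ^ 2 =
      n * ((β g).ofLp ⬝ᵥ (gram X g *ᵥ (β g).ofLp)) := by
    rw [gram, Matrix.smul_mulVec, dotProduct_smul, smul_eq_mul, mul_inv_cancel_left₀ hn'.ne',
      blockPred, norm_sq_toLp, ← Matrix.mulVec_mulVec, Matrix.mulVec_transpose,
      Matrix.dotProduct_mulVec, dotProduct_comm]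
  rw [colCoord_linPred hX, norm_colCoord_blockPred (hP g), hgram]
  have hpow : (n : ℝ) ^ (1 - 2 * b) = n * ((n : ℝ) ^ (-b)) ^ 2 := by
    rw [show 1 - 2 * b = 1 + -b + -b by ring, Real.rpow_add hn', Real.rpow_add hn', Real.rpow_one]
    ring
  calc C₁ * c ^ 2 * (n : ℝ) ^ (1 - 2 * b) = n * (C₁ * (c * (n : ℝ) ^ (-b)) ^ 2) := by
        rw [hpow]
        ring
    _ ≤ n * (eMin (gram X g) * ((β g).ofLp ⬝ᵥ (β g).ofLp)) := by
        have : 0 ≤ eMin (gram X g) := (hC₁.trans h1).le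
        gcongr
    _ ≤ _ := by gcongr

lemma signal_div_four_le_hatQuad (hP : ∀ g, ((X g)ᵀ * X g).PosDef) (hσ : 0 < σ)
    (β : ∀ g, EuclideanSpace ℝ (Fin (m g))) {g : Fin G} {V : ℝ} (hV : 0 < V)
    (hsig : V ≤ ‖colCoord (X g) (linPred X β)‖ ^ 2) {z : EuclideanSpace ℝ (Fin n)}
    (hz : hatQuad (X g) z < V / (4 * σ ^ 2)) :
    V / 4 ≤ hatQuad (X g) (linPred X β + σ • z) := by
  rw [← norm_colCoord_sq (hP g)] at hz ⊢
  rw [colCoord_add_smul]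
  have h1 : √V ≤ ‖colCoord (X g) (linPred X β)‖ := Real.sqrt_le_iff.mpr ⟨norm_nonneg _, hsig⟩
  have h2 : ‖σ • colCoord (X g) z‖ ≤ √V / 2 := by
    rw [norm_smul, Real.norm_of_nonneg hσ.le]
    refine abs_le_of_sq_le_sq' ?_ (by positivity) |>.2
    rw [lt_div_iff₀ (by positivity)] at hz
    rw [mul_pow, div_pow, Real.sq_sqrt hV.le]
    linarith
  have h3 := norm_sub_le_norm_add (colCoord (X g) (linPred X β)) (σ • colCoord (X g) z)
  have h4 : √V / 2 ≤ ‖colCoord (X g) (linPred X β) + σ • colCoord (X g) z‖ := by linarith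
  calc V / 4 = (√V / 2) ^ 2 := by
        rw [div_pow, Real.sq_sqrt hV.le]
        norm_num
    _ ≤ _ := by gcongr

variable {a τ : ℝ} {L : ℝ → ℝ}

/-- Both selection rules recover the active set as soon as the shrinkage factors are at most
`1 / 2` off the active set and larger than `1 / 2` on it: the posterior mean of an active group is
then a nonzero multiple of a nonzero least squares estimator. -/
lemma selection_eq_activeSet (hL : IsPriorFunction a L) (hX : IsBlockOrthogonal X)
    (hP : ∀ g, ((X g)ᵀ * X g).PosDef) (hσ : 0 < σ) (hτ : 0 < τ)
    (β : ∀ g, EuclideanSpace ℝ (Fin (m g))) {y : EuclideanSpace ℝ (Fin n)}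
    (h0 : ∀ g, β g = 0 → shrinkFactor a L X σ τ y g ≤ 1 / 2)
    (h1 : ∀ g, β g ≠ 0 → 1 / 2 < shrinkFactor a L X σ τ y g ∧ 0 < hatQuad (X g) y) :
    declaredActive a L X σ τ y = activeSet β ∧ estimatedActive a L X σ τ y = activeSet β := by
  have hd : ∀ g, 1 / 2 < shrinkFactor a L X σ τ y g ↔ β g ≠ 0 := fun g =>
    ⟨fun h hg => (h0 g hg).not_gt h, fun hg => (h1 g hg).1⟩
  refine ⟨Set.ext hd, Set.ext fun g => ?_⟩
  change htEstimator a L X σ τ y g ≠ 0 ↔ β g ≠ 0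
  rw [htEstimator]
  constructor
  · intro h
    rw [← hd]
    by_contra hn
    exact h (if_neg hn)
  · intro hg
    rw [if_pos ((hd g).mpr hg), postMean_eq hL hX hP hσ hτ]
    obtain ⟨h2, h3⟩ := h1 g hg
    refine smul_ne_zero (by linarith) fun h4 => h3.ne' ?_
    have h5 : ((X g)ᵀ * X g)⁻¹ *ᵥ ((X g)ᵀ *ᵥ y.ofLp) = 0 := congrArg WithLp.ofLp h4
    rw [hatQuad, h5, dotProduct_zero]

/-- The probability of correct selection, in terms of an upper bound `B exp H` and a lower bound
`3 / 4 - D exp (-H / 8)` for the shrinkage factors, where `H = hatQuad X y / (2 σ²)`. -/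
lemma one_sub_le_selection_probability (hL : IsPriorFunction a L) (hX : IsBlockOrthogonal X)
    (hP : ∀ g, ((X g)ᵀ * X g).PosDef) (hσ : 0 < σ) (hτ : 0 < τ)
    (β : ∀ g, EuclideanSpace ℝ (Fin (m g))) {s : ℕ} (hs : ∀ g, m g ≤ s) {θ : ℝ} (hθ0 : 0 < θ)
    (hθ : θ < 1) {B D V : ℝ} (hB : 0 < B) (hD : 0 < D) (hV : 0 < V)
    (hup : ∀ y g, shrinkFactor a L X σ τ y g ≤
      B * Real.exp (hatQuad (X g) y / (2 * σ ^ 2)))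
    (hlow : ∀ y g, 3 / 4 - D * Real.exp (-(hatQuad (X g) y / (2 * σ ^ 2)) / 8) ≤
      shrinkFactor a L X σ τ y g)
    (hDV : D * Real.exp (-(V / (64 * σ ^ 2))) < 1 / 4)
    (hsig : ∀ g, β g ≠ 0 → V ≤ ‖colCoord (X g) (linPred X β)‖ ^ 2) :
    1 - G * ((√(1 - θ))⁻¹ ^ s * ((2 * B) ^ θ + Real.exp (-(θ * V / (8 * σ ^ 2))))) ≤
      (dataLaw X σ β).real {y | declaredActive a L X σ τ y = activeSet β ∧
        estimatedActive a L X σ τ y = activeSet β} := by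
  classical
  -- The noise threshold of an inactive group solves `B exp (x / 2) = 1 / 2`.
  set x : Fin G → ℝ := fun g => if β g = 0 then -2 * Real.log (2 * B) else V / (4 * σ ^ 2)
    with hx
  refine le_trans ?_ (one_sub_sum_le_dataLaw_real hP hσ β hs hθ0 hθ x _ fun z hz => ?_)
  · have hle : ∀ g, (√(1 - θ))⁻¹ ^ s * Real.exp (-(θ * x g / 2)) ≤
        (√(1 - θ))⁻¹ ^ s * ((2 * B) ^ θ + Real.exp (-(θ * V / (8 * σ ^ 2)))) := by
      intro g
      refine mul_le_mul_of_nonneg_left ?_ (by positivity)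
      by_cases hg : β g = 0
      · have h1 : Real.exp (-(θ * x g / 2)) = (2 * B) ^ θ := by
          rw [Real.rpow_def_of_pos (by positivity), hx]
          simp only [hg, if_true]
          congr 1
          ring
        have := Real.exp_pos (-(θ * V / (8 * σ ^ 2)))
        linarith
      · have h1 : -(θ * x g / 2) = -(θ * V / (8 * σ ^ 2)) := by
          rw [hx]
          simp only [hg, if_false]
          field_simp
          norm_num
        have : 0 ≤ (2 * B) ^ θ := by positivity
        rw [h1]
        linarith
    have h2 := Finset.sum_le_sum fun g (_ : g ∈ Finset.univ) => hle g
    rw [Finset.sum_const, Finset.card_univ, Fintype.card_fin, nsmul_eq_mul] at h2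
    linarith
  · refine selection_eq_activeSet hL hX hP hσ hτ β (fun g hg => ?_) fun g hg => ?_
    · have h1 : hatQuad (X g) z < -2 * Real.log (2 * B) := by
        have := hz g
        rw [hx] at this
        simpa only [hg, if_true] using this
      refine (hup _ g).trans ?_
      rw [hatQuad_data_of_inactive hX hP β hg]
      have h2 : σ ^ 2 * hatQuad (X g) z / (2 * σ ^ 2) ≤ -Real.log (2 * B) := by
        rw [div_le_iff₀ (by positivity)]
        have : 0 < σ ^ 2 := by positivity
        nlinarith
      calc B * Real.exp (σ ^ 2 * hatQuad (X g) z / (2 * σ ^ 2)) ≤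
            B * Real.exp (-Real.log (2 * B)) := by gcongr
        _ = 1 / 2 := by
          rw [Real.exp_neg, Real.exp_log (by positivity)]
          field_simp
    · have h1 : hatQuad (X g) z < V / (4 * σ ^ 2) := by
        have := hz g
        rw [hx] at this
        simpa only [hg, if_false] using this
      have h2 := signal_div_four_le_hatQuad hP hσ β hV (hsig g hg) h1
      refine ⟨lt_of_lt_of_le ?_ (hlow _ g), by linarith⟩
      have h3 : -(hatQuad (X g) (linPred X β + σ • z) / (2 * σ ^ 2)) / 8 ≤
          -(V / (64 * σ ^ 2)) := by
        rw [neg_div, neg_le_neg_iff, div_div, div_le_div_iff₀ (by positivity) (by positivity)]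
        have : 0 < σ ^ 2 := by positivity
        nlinarith
      have h4 : D * Real.exp (-(hatQuad (X g) (linPred X β + σ • z) / (2 * σ ^ 2)) / 8) ≤
          D * Real.exp (-(V / (64 * σ ^ 2))) := by gcongr
      linarith

end Selection

/-! ### Rates -/

section Rates

lemma tendsto_rpow_mul_exp_neg_rpow (w : ℝ) {κ d : ℝ} (hκ : 0 < κ) (hd : 0 < d) :
    Tendsto (fun n : ℕ => (n : ℝ) ^ w * Real.exp (-κ * (n : ℝ) ^ d)) atTop (𝓝 0) := by
  have h1 : Tendsto (fun n : ℕ => (n : ℝ) ^ d) atTop atTop :=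
    (tendsto_rpow_atTop hd).comp tendsto_natCast_atTop_atTop
  refine ((tendsto_rpow_mul_exp_neg_mul_atTop_nhds_zero (w / d) κ hκ).comp h1).congr fun n => ?_
  simp only [Function.comp_apply]
  rw [← Real.rpow_mul (Nat.cast_nonneg n), mul_div_cancel₀ _ hd.ne']

/-- If `τ` is at most of order `G ^ (-E)`, then `G` grows slower than `τ ^ (-w)` for each
`w > 1 / E`. -/
lemma tendsto_mul_rpow_of_le_rpow_neg {G τ : ℕ → ℝ} (hτ : ∀ n, 0 < τ n)
    (hτ0 : Tendsto τ atTop (𝓝 0)) {E K w : ℝ} (hE : 0 < E) (hK : 0 < K)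
    (hG : ∀ᶠ n in atTop, 0 < G n) (h : ∀ᶠ n in atTop, τ n ≤ K * G n ^ (-E)) (hw : 1 / E < w) :
    Tendsto (fun n => G n * τ n ^ w) atTop (𝓝 0) := by
  have hlim : Tendsto (fun n => K ^ (1 / E) * τ n ^ (w - 1 / E)) atTop (𝓝 0) := by
    have hw' : 0 < w - 1 / E := by linarith
    have h := (hτ0.rpow_const (Or.inr hw'.le)).const_mul (K ^ (1 / E))
    rwa [Real.zero_rpow hw'.ne', mul_zero] at h
  refine squeeze_zero' ?_ ?_ hlim
  · filter_upwards [hG] with n hn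
    exact mul_nonneg hn.le (Real.rpow_nonneg (hτ n).le _)
  · filter_upwards [hG, h] with n hn hle
    have h1 : G n ^ E ≤ K * (τ n)⁻¹ := by
      have hGE : 0 < G n ^ E := Real.rpow_pos_of_pos hn _
      rw [Real.rpow_neg hn.le, ← div_eq_mul_inv, le_div_iff₀ hGE] at hle
      rw [← div_eq_mul_inv, le_div_iff₀ (hτ n)]
      linarith
    have h2 : G n ≤ K ^ (1 / E) * τ n ^ (-(1 / E)) := by
      calc G n = (G n ^ E) ^ (1 / E) := by
            rw [← Real.rpow_mul hn.le, mul_one_div_cancel hE.ne', Real.rpow_one]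
        _ ≤ (K * (τ n)⁻¹) ^ (1 / E) := by gcongr
        _ = _ := by
          have := hτ n
          rw [Real.mul_rpow hK.le (by positivity), Real.inv_rpow this.le, Real.rpow_neg this.le]
    calc G n * τ n ^ w ≤ K ^ (1 / E) * τ n ^ (-(1 / E)) * τ n ^ w := by
          have := Real.rpow_nonneg (hτ n).le w
          gcongr
      _ = _ := by
          rw [mul_assoc, ← Real.rpow_add (hτ n)]
          ring_nf

end Rates

end GroupHT

/-! ### Selection consistency -/

theorem theorem1
    -- the local prior
    (a : ℝ) (ha : 1 / 2 ≤ a) (L : ℝ → ℝ)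
    (hL : GroupHT.IsPriorFunction a L) (hLbdd : GroupHT.IsTailBounded L)
    -- the error standard deviation, fixed
    (σ : ℝ) (hσ : 0 < σ)
    -- the sequence of models, indexed by the sample size
    (G : ℕ → ℕ) (hG : ∀ n, G n ≤ n)
    (m : ∀ n, Fin (G n) → ℕ)
    (X : ∀ n, ∀ g : Fin (G n), Matrix (Fin n) (Fin (m n g)) ℝ)
    (hrank : ∀ n g, (X n g).rank = m n g)
    (horth : ∀ n, GroupHT.IsBlockOrthogonal (X n))
    (β₀ : ∀ n, ∀ g : Fin (G n), EuclideanSpace ℝ (Fin (m n g)))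
    -- eigenvalues of the active Gram blocks
    (C₁ : ℝ) (hC₁ : 0 < C₁)
    (hA1 : ∀ n, ∀ g ∈ GroupHT.activeSet (β₀ n), C₁ < GroupHT.eMin (GroupHT.gram (X n) g))
    -- minimal signal
    (c b : ℝ) (hc : 0 < c) (hb0 : 0 ≤ b) (hb : b < 1 / 2)
    (hA2 : ∀ n, ∀ g ∈ GroupHT.activeSet (β₀ n), ∀ j, c * (n : ℝ) ^ (-b) < |β₀ n g j|)
    -- bounded group sizes
    (hA3 : ∃ s : ℕ, ∀ n g, m n g ≤ s)
    -- number of active groups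
    (ε₁ ε₂ : ℝ) (hε₁ : 0 ≤ ε₁) (hε₁₂ : ε₁ < ε₂) (hε₂ : ε₂ < 1)
    (hB1l : (fun n => (G n : ℝ) ^ ε₁) =O[atTop]
      fun n => ((GroupHT.activeSet (β₀ n)).ncard : ℝ))
    (hB1u : (fun n => ((GroupHT.activeSet (β₀ n)).ncard : ℝ)) =O[atTop]
      fun n => (G n : ℝ) ^ ε₂)
    -- the window for the global parameter
    (r : ℕ → ℝ) (hr : ∀ n, r n = ((GroupHT.activeSet (β₀ n)).ncard : ℝ) / (G n : ℝ))
    (δ₁ δ₂ : ℝ) (hδ₁₂ : δ₁ < δ₂) (hδ₁ : (ε₂ - ε₁) / (1 - ε₂) < δ₁)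
    (τ : ℕ → ℝ) (hτpos : ∀ n, 0 < τ n) (hτ0 : Tendsto τ atTop (𝓝 0))
    (hB2l : (fun n => r n ^ ((1 + δ₂) / (1 - ε₂))) =O[atTop] τ)
    (hB2u : τ =O[atTop] fun n => r n ^ ((1 + δ₁) / (1 - ε₁))) :
    Tendsto (fun n => (GroupHT.dataLaw (X n) σ (β₀ n)).real
        {y | GroupHT.declaredActive a L (X n) σ (τ n) y = GroupHT.activeSet (β₀ n)})
      atTop (𝓝 1) ∧
    Tendsto (fun n => (GroupHT.dataLaw (X n) σ (β₀ n)).real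
        {y | GroupHT.estimatedActive a L (X n) σ (τ n) y = GroupHT.activeSet (β₀ n)})
      atTop (𝓝 1) := by
  obtain ⟨s, hs⟩ := hA3
  have hP : ∀ n g, ((X n g)ᵀ * X n g).PosDef := fun n g =>
    GroupHT.gram_posDef_of_rank (hrank n g)
  have hε₁' : 0 < 1 - ε₁ := by linarith
  have hε₂' : 0 < 1 - ε₂ := by linarith
  have hδ : ε₂ - ε₁ < δ₁ * (1 - ε₂) := by rwa [div_lt_iff₀ hε₂'] at hδ₁
  have hδ₁0 : 0 < δ₁ := lt_trans (div_pos (by linarith) hε₂') hδ₁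
  set p₁ := (1 + δ₁) / (1 - ε₁) with hp₁
  set p₂ := (1 + δ₂) / (1 - ε₂) with hp₂
  have hp₁0 : 0 < p₁ := div_pos (by linarith) hε₁'
  have hp₂0 : 0 < p₂ := div_pos (by linarith) hε₂'
  -- The window for `τ` makes it of smaller order than `1 / G`, with exponent `E > 1`.
  set E := (1 - ε₂) * p₁ with hE
  have hE1 : 1 < E := by
    rw [hE, hp₁, mul_div_assoc', lt_div_iff₀ hε₁']
    linarith
  -- An exponent `q < 1` with `q ^ 2 > 1 / E`, used both for the prior moment of order `q / 2` and
  -- for the exponential moment of the noise.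
  set q := (1 + 1 / E) / 2 with hq
  have hEinv : 0 < 1 / E := by positivity
  have hEinv1 : 1 / E < 1 := by
    rw [div_lt_one (by linarith)]
    exact hE1
  have hq0 : 0 < q := by linarith
  have hq1 : q < 1 := by linarith
  have hqq : 1 / E < q * q := by nlinarith
  obtain ⟨B, hB, hup⟩ := GroupHT.exists_shrink_upper_bound hL hLbdd ha
    (half_pos hq0) (by linarith : q / 2 < 1 / 2) s
  obtain ⟨D, hD, τ₁, hτ₁, hlow⟩ := GroupHT.exists_shrink_lower_bound hL hLbdd ha s
  obtain ⟨K₁, hK₁, hB2u'⟩ := hB2u.exists_pos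
  obtain ⟨K₂, hK₂, hB1u'⟩ := hB1u.exists_pos
  obtain ⟨K₃, hK₃, hB2l'⟩ := hB2l.exists_pos
  have hr0 : ∀ n, 0 ≤ r n := fun n => by
    rw [hr]
    positivity
  -- Both `G n` and the number of active groups are eventually positive, since `τ n > 0`.
  have hpos : ∀ᶠ n in atTop, 0 < ((GroupHT.activeSet (β₀ n)).ncard : ℝ) ∧ 0 < (G n : ℝ) := by
    filter_upwards [hB2u'.bound] with n hn
    have hrn : r n ≠ 0 := by
      intro h
      rw [h, Real.zero_rpow hp₁0.ne', norm_zero, mul_zero] at hn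
      exact absurd (norm_le_zero_iff.mp hn) (hτpos n).ne'
    rw [hr] at hrn
    constructor
    · exact lt_of_le_of_ne (Nat.cast_nonneg _) fun h => hrn (by rw [← h, zero_div])
    · exact lt_of_le_of_ne (Nat.cast_nonneg _) fun h => hrn (by rw [← h, div_zero])
  have hτG : ∀ᶠ n in atTop, τ n ≤ K₁ * K₂ ^ p₁ * (G n : ℝ) ^ (-E) := by
    filter_upwards [hB2u'.bound, hB1u'.bound, hpos] with n h1 h2 ⟨_, hGn⟩
    rw [Real.norm_of_nonneg (hτpos n).le, Real.norm_of_nonneg (Real.rpow_nonneg (hr0 n) _)] at h1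
    rw [Real.norm_of_nonneg (Nat.cast_nonneg _),
      Real.norm_of_nonneg (Real.rpow_nonneg hGn.le _)] at h2
    have h3 : r n ≤ K₂ * (G n : ℝ) ^ (-(1 - ε₂)) := by
      rwa [hr, div_le_iff₀ hGn, mul_assoc, ← Real.rpow_add_one hGn.ne',
        show -(1 - ε₂) + 1 = ε₂ by ring]
    calc τ n ≤ K₁ * r n ^ p₁ := h1
      _ ≤ K₁ * (K₂ * (G n : ℝ) ^ (-(1 - ε₂))) ^ p₁ := by
        have := hr0 n
        gcongr
      _ = K₁ * K₂ ^ p₁ * (G n : ℝ) ^ (-E) := by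
        rw [Real.mul_rpow hK₂.le (by positivity), ← Real.rpow_mul hGn.le, hE, neg_mul, mul_assoc]
  have hτn : ∀ᶠ n : ℕ in atTop, τ n ^ (-(2 * a)) ≤ K₃ ^ (2 * a) * (n : ℝ) ^ (p₂ * (2 * a)) := by
    filter_upwards [hB2l'.bound, hpos] with n h1 ⟨hAn, hGn⟩
    rw [Real.norm_of_nonneg (hτpos n).le, Real.norm_of_nonneg (Real.rpow_nonneg (hr0 n) _)] at h1
    have hn : (0 : ℝ) < n := hGn.trans_le (Nat.cast_le.mpr (hG n))
    have h2 : (n : ℝ)⁻¹ ≤ r n := by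
      rw [hr, ← one_div]
      have hA1 : (1 : ℝ) ≤ ((GroupHT.activeSet (β₀ n)).ncard : ℝ) := by
        exact_mod_cast Nat.cast_pos.mp hAn
      have hGn' : (G n : ℝ) ≤ n := Nat.cast_le.mpr (hG n)
      gcongr
    have h3 : (τ n)⁻¹ ≤ K₃ * (n : ℝ) ^ p₂ := by
      have h4 : ((n : ℝ) ^ p₂)⁻¹ ≤ K₃ * τ n := by
        rw [← Real.inv_rpow hn.le]
        exact (Real.rpow_le_rpow (by positivity) h2 hp₂0.le).trans h1
      have h5 : 0 < (n : ℝ) ^ p₂ := Real.rpow_pos_of_pos hn _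
      rw [inv_le_iff_one_le_mul₀ h5] at h4
      rw [inv_le_iff_one_le_mul₀ (hτpos n)]
      linarith
    calc τ n ^ (-(2 * a)) = (τ n)⁻¹ ^ (2 * a) := by
          rw [Real.rpow_neg (hτpos n).le, Real.inv_rpow (hτpos n).le]
      _ ≤ (K₃ * (n : ℝ) ^ p₂) ^ (2 * a) := by
          have := inv_pos.mpr (hτpos n)
          gcongr
      _ = _ := by rw [Real.mul_rpow hK₃.le (by positivity), ← Real.rpow_mul hn.le]
  have hd : 0 < 1 - 2 * b := by linarith
  have hσ2 : 0 < σ ^ 2 := by positivity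
  set V : ℕ → ℝ := fun n => C₁ * c ^ 2 * (n : ℝ) ^ (1 - 2 * b) with hVdef
  have hDV : ∀ᶠ n in atTop,
      D * τ n ^ (-(2 * a)) * Real.exp (-(V n / (64 * σ ^ 2))) < 1 / 4 := by
    have hlim := (GroupHT.tendsto_rpow_mul_exp_neg_rpow (p₂ * (2 * a))
      (κ := C₁ * c ^ 2 / (64 * σ ^ 2)) (by positivity) hd).const_mul (D * K₃ ^ (2 * a))
    rw [mul_zero] at hlim
    filter_upwards [hlim.eventually_lt_const (by norm_num : (0 : ℝ) < 1 / 4), hτn] with n h1 h2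
    refine lt_of_le_of_lt ?_ h1
    have hexp : -(C₁ * c ^ 2 / (64 * σ ^ 2)) * (n : ℝ) ^ (1 - 2 * b) =
        -(V n / (64 * σ ^ 2)) := by
      rw [hVdef]
      ring
    rw [hexp]
    calc D * τ n ^ (-(2 * a)) * Real.exp (-(V n / (64 * σ ^ 2))) ≤
          D * (K₃ ^ (2 * a) * (n : ℝ) ^ (p₂ * (2 * a))) * Real.exp (-(V n / (64 * σ ^ 2))) := by
          gcongr
      _ = _ := by ring
  set bad : ℕ → ℝ := fun n => (G n : ℝ) * ((√(1 - q))⁻¹ ^ s *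
    ((2 * (B * τ n ^ q)) ^ q + Real.exp (-(q * V n / (8 * σ ^ 2))))) with hbad
  have hbad0 : Tendsto bad atTop (𝓝 0) := by
    have hl1 := (GroupHT.tendsto_mul_rpow_of_le_rpow_neg hτpos hτ0 (by linarith : 0 < E)
      (by positivity : 0 < K₁ * K₂ ^ p₁) (hpos.mono fun n hn => hn.2) hτG hqq).const_mul
      ((√(1 - q))⁻¹ ^ s * (2 * B) ^ q)
    have hl2 := (GroupHT.tendsto_rpow_mul_exp_neg_rpow 1
      (κ := q * (C₁ * c ^ 2) / (8 * σ ^ 2)) (by positivity) hd).const_mul ((√(1 - q))⁻¹ ^ s)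
    have hl := hl1.add hl2
    rw [mul_zero, mul_zero, add_zero] at hl
    refine squeeze_zero (fun n => ?_) (fun n => ?_) hl
    · have := hτpos n
      positivity
    · have hτn0 := hτpos n
      have h1 : (2 * (B * τ n ^ q)) ^ q = (2 * B) ^ q * τ n ^ (q * q) := by
        rw [← mul_assoc, Real.mul_rpow (by positivity) (by positivity), ← Real.rpow_mul hτn0.le]
      have h2 : -(q * (C₁ * c ^ 2) / (8 * σ ^ 2)) * (n : ℝ) ^ (1 - 2 * b) =
          -(q * V n / (8 * σ ^ 2)) := by
        rw [hVdef]
        ring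
      have hGn' : (G n : ℝ) ≤ n := Nat.cast_le.mpr (hG n)
      rw [Real.rpow_one, h2]
      simp only [hbad, h1]
      have h3 : (√(1 - q))⁻¹ ^ s * ((G n : ℝ) * Real.exp (-(q * V n / (8 * σ ^ 2)))) ≤
          (√(1 - q))⁻¹ ^ s * ((n : ℝ) * Real.exp (-(q * V n / (8 * σ ^ 2)))) := by gcongr
      linarith
  have hprob : ∀ n, IsProbabilityMeasure (GroupHT.dataLaw (X n) σ (β₀ n)) := fun n => by
    unfold GroupHT.dataLaw
    infer_instance
  have hmain : ∀ᶠ n in atTop, 1 - bad n ≤ (GroupHT.dataLaw (X n) σ (β₀ n)).real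
      {y | GroupHT.declaredActive a L (X n) σ (τ n) y = GroupHT.activeSet (β₀ n) ∧
        GroupHT.estimatedActive a L (X n) σ (τ n) y = GroupHT.activeSet (β₀ n)} := by
    filter_upwards [hDV, hpos, hτ0.eventually_le_const (lt_min one_pos hτ₁)]
      with n hDVn ⟨_, hGn⟩ hτle
    have hn : 0 < n := Nat.cast_pos.mp (hGn.trans_le (Nat.cast_le.mpr (hG n)))
    have hn' : (0 : ℝ) < n := Nat.cast_pos.mpr hn
    have hτn0 := hτpos n
    refine GroupHT.one_sub_le_selection_probability hL (horth n) (hP n) hσ hτn0 (β₀ n) (hs n)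
      hq0 hq1 (by positivity) (by positivity) (by positivity) (fun y g => ?_) (fun y g => ?_)
      hDVn fun g hg => ?_
    · rw [GroupHT.shrinkFactor_eq hL (horth n) (hP n) hσ hτn0]
      have h := hup (X n g) σ (τ n) y (hP n g) (hs n g) hτn0 (hτle.trans (min_le_left _ _))
      rwa [mul_div_cancel₀ q two_ne_zero] at h
    · rw [GroupHT.shrinkFactor_eq hL (horth n) (hP n) hσ hτn0]
      exact hlow (X n g) σ (τ n) y (hP n g) (hs n g) hτn0 (hτle.trans (min_le_right _ _))
    · exact GroupHT.signal_le_norm_colCoord (horth n) (hP n) hn (β₀ n) hg hC₁ hc (hA1 n g hg)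
        (hA2 n g hg)
  have hlim : Tendsto (fun n => 1 - bad n) atTop (𝓝 1) := by
    simpa using hbad0.const_sub 1
  refine ⟨tendsto_of_tendsto_of_tendsto_of_le_of_le' hlim tendsto_const_nhds ?_
      (Eventually.of_forall fun n => measureReal_le_one),
    tendsto_of_tendsto_of_tendsto_of_le_of_le' hlim tendsto_const_nhds ?_
      (Eventually.of_forall fun n => measureReal_le_one)⟩
  · filter_upwards [hmain] with n hn
    exact hn.trans (measureReal_mono fun y hy => hy.1)
  · filter_upwards [hmain] with n hn
    exact hn.trans (measureReal_mono fun y hy => hy.2)
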